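/- All matroids are finite. For a matroid $M$ with ground set $E(M)$ and rank function $r$, let $\lambda_M(X)=r(X)+r(E(M)-X)-r(M)$ for $X\subseteq E(M)$. A partition $(X,E(M)-X)$ is a $k$-separation of $M$ if $\lambda_M(X)<k$ and $|X|,|E(M)-X|\geq k$, and $M$ is $3$-connected if it has no $k$-separation with $k<3$. We say that $M$ has an $N$-minor if some minor of $M$ is isomorphic to $N$. The simple matroid associated with $M$, obtained by deleting all loops and all but one element of each parallel class, is denoted $\mathrm{si}(M)$, and $\mathrm{co}(M)=(\mathrm{si}(M^*))^*$ is the cosimple matroid associated with $M$. A four-element fan of $M$ is a sequence $(x_1,x_2,x_3,x_4)$ of distinct elements of $E(M)$ such that $\{x_1,x_2,x_3\}$ is a circuit and $\{x_2,x_3,x_4\}$ is a cocircuit. **Theorem.** Suppose that $M$ and $N$ are $3$-connected matroids such that $|E(N)|\geq 4$, and that $C^*$ is a cocircuit of $M$ such that $M/x_0$ has an $N$-minor for some $x_0\in C^*$. Then at least one of the following holds: (i) there is an element $x\in C^*$ such that $\mathrm{si}(M/x)$ is $3$-connected and has an $N$-minor; (ii) there is an element $x\in C^*$ such that $\mathrm{co}(\mathrm{si}(M/x))$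 is $3$-connected and has an $N$-minor; (iii) there is a four-element fan $(x_1,x_2,x_3,x_4)$ of $M$ such that $x_1,x_3\in C^*$, and $\mathrm{si}(M/x_2)$ is $3$-connected and has an $N$-minor. -/

import Mathlib

open Set
open scoped Matroid

noncomputable section

namespace Matroid

universe u v

variable {α : Type u} {β : Type v}

/-- The rank of the set `X` in `M`, as a natural number (for matroids of finite rank). -/
def rkNat (M : Matroid α) (X : Set α) : ℕ := (M.eRk X).toNat

/-- The connectivity function `λ_M(X) = r(X) + r(E - X) - r(M)` of a finite matroid. -/
def connFun (M : Matroid α) (X : Set α) : ℤ :=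
  (M.rkNat X : ℤ) + (M.rkNat (M.E \ X) : ℤ) - (M.rkNat M.E : ℤ)

/-- `(X, E - X)` is a `k`-separation of `M`: `λ_M(X) < k` and both sides have at least
`k` elements. -/
def IsSeparation (M : Matroid α) (k : ℕ) (X : Set α) : Prop :=
  X ⊆ M.E ∧ M.connFun X < (k : ℤ) ∧ (k : ℕ∞) ≤ X.encard ∧ (k : ℕ∞) ≤ (M.E \ X).encard

/-- `M` is `n`-connected if it has no `k`-separation with `k < n`. -/
def IsNConnected (M : Matroid α) (n : ℕ) : Prop :=
  ∀ k < n, ∀ X : Set α, ¬ M.IsSeparation k X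

/-- `M` and `N` are isomorphic: some bijection between the ground sets preserves independence
in both directions. -/
def IsIsomorphic (M : Matroid α) (N : Matroid β) : Prop :=
  ∃ e : M.E ≃ N.E, ∀ I : Set M.E, M.Indep (Subtype.val '' I) ↔ N.Indep (Subtype.val '' (e '' I))

/-- `M` has an `N`-minor: some minor of `M` is isomorphic to `N`. -/
def HasMinor (M : Matroid α) (N : Matroid β) : Prop :=
  ∃ M' : Matroid α, M' ≤m M ∧ M'.IsIsomorphic N

/-- The parallel class of `e` (when `e` is not a loop): all nonloops in the closure of `e`. -/
def parallelClass (M : Matroid α) (e : α) : Set α := M.closure {e} \ M.loops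

open Classical in
/-- A chosen element of the parallel class of `e`; it depends only on the class. -/
def parallelRep (M : Matroid α) (e : α) : α :=
  if h : (M.parallelClass e).Nonempty then h.some else e

/-- The simple matroid `si(M)` associated with `M`: delete all loops, and all but one element of
each parallel class. -/
def si (M : Matroid α) : Matroid α := M ↾ (M.parallelRep '' {e | M.IsNonloop e})

/-- The cosimple matroid `co(M)` associated with `M`: the dual of the simplification of the
dual. -/
def co (M : Matroid α) : Matroid α := (M✶.si)✶

/-- A triangle is a three-element circuit. -/
def IsTriangle (M : Matroid α) (T : Set α) : Prop := M.IsCircuit T ∧ T.encard = 3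

/-- A triad is a three-element cocircuit. -/
def IsTriad (M : Matroid α) (T : Set α) : Prop := M.IsCocircuit T ∧ T.encard = 3

/-- `(x₁, x₂, x₃, x₄)` is a four-element fan of `M`: the `xᵢ` are distinct elements,
`{x₁, x₂, x₃}` is a triangle and `{x₂, x₃, x₄}` is a triad. -/
def IsFourElementFan (M : Matroid α) (x₁ x₂ x₃ x₄ : α) : Prop :=
  [x₁, x₂, x₃, x₄].Nodup ∧ M.IsTriangle {x₁, x₂, x₃} ∧ M.IsTriad {x₂, x₃, x₄}

end Matroid

end

namespace Matroid

variable {α β : Type*} {M N : Matroid α} {X Y Z C D : Set α} {e f x s : α}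

/-! Suppose all three outcomes fail, and write C* for the cocircuit. If x ∈ C* and M/x has an
N-minor, then so has si(M/x), which is therefore not 3-connected, and M has a vertical 3-separation
(X, x, Y) (`exists_isVertSep`). In M/x this is a 2-separation, so one side, say X, contains at most
one element of the N-minor. If moreover Y ∪ x is a flat, then contracting any element of X keeps an
N-minor (`IsVertSep.exists_isIsomorphic_contract`). Choosing such a separation with X
inclusion-minimal, every s ∈ X ∩ C* has a vertical 3-separation of its own, but none with a side
inside X (`exists_isMinVertSep`). From here on N plays no part (`IsMinVertSep.false`).

Let (X', s, Y') be a vertical 3-separation at s ∈ X ∩ C*, with Y' ∪ s a flat and x ∈ Y'. Uncrossing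
it with (X, x, Y), minimality forces pieces of X onto lines: if |X ∩ X'| ≥ 2, then (X ∩ X') ∪ s lies
on a line; if |Y ∩ X'| ≥ 2, then (X ∩ Y') ∪ {s, x} lies on a line. The aim is a line L with three
elements l such that (L \ l) ∪ d has nonspanning complement for some d = d(l) outside L. Then
co(si(M/l)) is 3-connected (`isNConnected_co_si_contract`), since contracting l turns L \ l into a
parallel class whose representative is in series with d, and a separation that keeps L \ l and d
together can be turned into one of M. This contradicts the failure of (ii).

There are two sources of L. If some X ∩ X' is a single element, then L = (X ∩ Y') ∪ {s, x}, and x, s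
and some m ∈ X ∩ Y' are the three elements (`IsMinVertSep.false_of_subsingleton`). Otherwise every
X' is (L \ s) ∪ c with L a line inside X. In both cases the third element may fail to lie in C*;
then L is a triangle belonging to a four-element fan, and the failure of (iii) supplies the missing
vertical 3-separation. -/

lemma two_le_encard_iff_nontrivial : (2 : ℕ∞) ≤ X.encard ↔ X.Nontrivial := by
  rw [← one_lt_encard_iff_nontrivial, ← one_add_one_eq_two, ENat.add_one_le_iff (by simp)]

/-! ### Natural-number rank calculus. -/

section Rank

lemma coe_rkNat (M : Matroid α) [M.Finite] (X : Set α) : (M.rkNat X : ℕ∞) = M.eRk X := by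
  rw [rkNat, ENat.natCast_toNat]
  have h := (M.eRk_le_eRank X).trans_lt (eRank_lt_top_iff.2 inferInstance)
  exact h.ne

lemma rkNat_mono (M : Matroid α) [M.Finite] (h : X ⊆ Y) : M.rkNat X ≤ M.rkNat Y := by
  have := M.eRk_mono h
  rw [← coe_rkNat, ← coe_rkNat] at this
  exact_mod_cast this

lemma rkNat_submod (M : Matroid α) [M.Finite] (X Y : Set α) :
    M.rkNat (X ∩ Y) + M.rkNat (X ∪ Y) ≤ M.rkNat X + M.rkNat Y := by
  have := M.eRk_inter_add_eRk_union_le X Y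
  simp only [← coe_rkNat] at this
  exact_mod_cast this

lemma rkNat_union_le (M : Matroid α) [M.Finite] (X Y : Set α) :
    M.rkNat (X ∪ Y) ≤ M.rkNat X + M.rkNat Y := by
  have := M.rkNat_submod X Y
  omega

@[simp] lemma rkNat_closure (M : Matroid α) (X : Set α) : M.rkNat (M.closure X) = M.rkNat X := by
  simp [rkNat]

@[simp] lemma rkNat_empty (M : Matroid α) : M.rkNat ∅ = 0 := by simp [rkNat]

lemma rkNat_insert_le (M : Matroid α) [M.Finite] (e : α) (X : Set α) :
    M.rkNat (insert e X) ≤ M.rkNat X + 1 := by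
  have := M.eRk_insert_le_add_one e X
  simp only [← coe_rkNat] at this
  exact_mod_cast this

lemma rkNat_singleton_le (M : Matroid α) [M.Finite] (e : α) : M.rkNat {e} ≤ 1 := by
  simpa using M.rkNat_insert_le e ∅

lemma rkNat_pair_le (M : Matroid α) [M.Finite] (e f : α) : M.rkNat {e, f} ≤ 2 :=
  (M.rkNat_insert_le e {f}).trans (by have := M.rkNat_singleton_le f; omega)

lemma rkNat_inter_ground (M : Matroid α) (X : Set α) : M.rkNat (X ∩ M.E) = M.rkNat X := by
  simp [rkNat]

lemma rkNat_le_ground (M : Matroid α) [M.Finite] (X : Set α) : M.rkNat X ≤ M.rkNat M.E := by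
  rw [← rkNat_inter_ground]
  exact M.rkNat_mono inter_subset_right

lemma rkNat_eq_of_subset_closure (hXY : X ⊆ Y) (hY : Y ⊆ M.closure X) [M.Finite] :
    M.rkNat Y = M.rkNat X :=
  ((M.rkNat_mono hY).trans_eq (M.rkNat_closure X)).antisymm (M.rkNat_mono hXY)

lemma rkNat_insert_of_mem_closure (h : e ∈ M.closure X) : M.rkNat (insert e X) = M.rkNat X := by
  rw [← rkNat_closure, closure_insert_eq_of_mem_closure h, rkNat_closure]

lemma rkNat_insert_of_notMem_closure [M.Finite] (he : e ∈ M.E) (h : e ∉ M.closure X) :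
    M.rkNat (insert e X) = M.rkNat X + 1 := by
  have := M.eRk_insert_eq_add_one (e := e) (X := X) ⟨he, h⟩
  simp only [← coe_rkNat] at this
  exact_mod_cast this

lemma mem_closure_iff_rkNat [M.Finite] (he : e ∈ M.E) :
    e ∈ M.closure X ↔ M.rkNat (insert e X) ≤ M.rkNat X := by
  refine ⟨fun h ↦ (rkNat_insert_of_mem_closure h).le, fun h ↦ by_contra fun h' ↦ ?_⟩
  have := rkNat_insert_of_notMem_closure he h'
  omega

lemma subset_closure_of_rkNat_le [M.Finite] (hXY : X ⊆ Y) (hY : Y ⊆ M.E)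
    (h : M.rkNat Y ≤ M.rkNat X) : Y ⊆ M.closure X := by
  intro e he
  rw [mem_closure_iff_rkNat (hY he)]
  exact (M.rkNat_mono (insert_subset he hXY)).trans h

lemma rkNat_le_one_of_subsingleton (M : Matroid α) [M.Finite] (h : X.Subsingleton) :
    M.rkNat X ≤ 1 := by
  obtain rfl | ⟨a, rfl⟩ := h.eq_empty_or_singleton
  · simp
  exact M.rkNat_singleton_le a

lemma nontrivial_of_two_le_rkNat [M.Finite] (h : 2 ≤ M.rkNat X) : X.Nontrivial := by
  rw [← not_subsingleton_iff]
  intro hX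
  have := M.rkNat_le_one_of_subsingleton hX
  omega

lemma indep_iff_rkNat [M.Finite] (hX : X.Finite) : M.Indep X ↔ M.rkNat X = X.ncard := by
  rw [indep_iff_eRk_eq_encard_of_finite hX, ← coe_rkNat, ← hX.cast_ncard_eq]
  norm_cast

end Rank

/-! ### Ranks in minors and duals. -/

section Minor

lemma rkNat_restrict (M : Matroid α) (h : X ⊆ Y) : (M ↾ Y).rkNat X = M.rkNat X := by
  simp [rkNat, restrict_eRk_eq _ h]

lemma rkNat_delete (M : Matroid α) (h : Disjoint X D) : (M ＼ D).rkNat X = M.rkNat X := by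
  rw [← rkNat_inter_ground, delete_eq_restrict, restrict_ground_eq, rkNat_restrict _ inter_subset_right,
    ← rkNat_inter_ground M X]
  congr 1
  tauto_set

lemma rkNat_contract_add (M : Matroid α) [M.Finite] (hZ : Z ⊆ M.E \ C) :
    (M ／ C).rkNat Z + M.rkNat C = M.rkNat (Z ∪ C) := by
  obtain ⟨I, hI⟩ := M.exists_isBasis' C
  obtain ⟨J, hJ⟩ := (M ／ C).exists_isBasis Z
  have hJ' : (M ／ I).IsBasis J Z := by
    rw [hI.contract_eq_contract_delete] at hJ
    exact hJ.of_delete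
  have hb := hI.indep.union_isBasis_union_of_contract_isBasis hJ'
  have h1 : M.eRk (Z ∪ C) = M.eRk (Z ∪ I) := by
    rw [union_comm, ← hI.eRk_eq_eRk_union, union_comm]
  have hdj : Disjoint J I := by
    have := hJ.subset.trans hZ
    exact (disjoint_of_subset_right hI.subset (disjoint_of_subset_left this disjoint_sdiff_left))
  have h2 : M.eRk (Z ∪ C) = (M ／ C).eRk Z + M.eRk C := by
    rw [h1, hb.eRk_eq_encard, encard_union_eq hdj, hJ.eRk_eq_encard, hI.eRk_eq_encard]
  rw [← coe_rkNat, ← coe_rkNat, ← coe_rkNat] at h2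
  exact_mod_cast h2.symm

lemma rkNat_minor_add (M : Matroid α) [M.Finite] (hZ : Z ⊆ (M ／ C ＼ D).E) :
    (M ／ C ＼ D).rkNat Z + M.rkNat C = M.rkNat (Z ∪ C) := by
  rw [rkNat_delete, rkNat_contract_add]
  · exact hZ.trans sdiff_subset
  · exact disjoint_of_subset_left hZ disjoint_sdiff_left

lemma rkNat_dual_add (M : Matroid α) [M.Finite] (hX : X ⊆ M.E) :
    M✶.rkNat X + M.rkNat M.E = M.rkNat (M.E \ X) + X.ncard := by
  have h := M.eRk_dual_add_eRank X hX
  rw [← eRk_ground, ← coe_rkNat, ← coe_rkNat, ← coe_rkNat,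
    ← (M.ground_finite.subset hX).cast_ncard_eq] at h
  exact_mod_cast h

lemma IsMinor.finite' [M.Finite] (h : N ≤m M) : N.Finite :=
  ⟨M.ground_finite.subset h.subset⟩

end Minor

/-! ### The connectivity function and 3-connectivity. -/

section Conn

/-- The sum of the ranks of a set and its complement. -/
noncomputable def rkSum (M : Matroid α) (X : Set α) : ℕ := M.rkNat X + M.rkNat (M.E \ X)

lemma connFun_eq (M : Matroid α) (X : Set α) :
    M.connFun X = (M.rkSum X : ℤ) - (M.rkNat M.E : ℤ) := by
  simp [connFun, rkSum]

lemma rkSum_submod (M : Matroid α) [M.Finite] (X Y : Set α) :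
    M.rkSum (X ∩ Y) + M.rkSum (X ∪ Y) ≤ M.rkSum X + M.rkSum Y := by
  have h1 := M.rkNat_submod X Y
  have h2 := M.rkNat_submod (M.E \ X) (M.E \ Y)
  rw [← sdiff_inter, sdiff_inter_sdiff] at h2
  simp only [rkSum]
  omega

lemma connFun_dual (M : Matroid α) [M.Finite] (hX : X ⊆ M.E) : M✶.connFun X = M.connFun X := by
  have h1 := M.rkNat_dual_add hX
  have h2 := M.rkNat_dual_add (sdiff_subset : M.E \ X ⊆ M.E)
  have h3 := M.rkNat_dual_add Subset.rfl
  rw [sdiff_sdiff_cancel_left hX] at h2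
  have h4 := ncard_sdiff_add_ncard_of_subset hX M.ground_finite
  simp only [sdiff_self, rkNat_empty] at h3
  simp only [connFun, dual_ground]
  omega

lemma isSeparation_dual_iff [M.Finite] {k : ℕ} : M✶.IsSeparation k X ↔ M.IsSeparation k X := by
  refine and_congr_right fun h ↦ ?_
  rw [connFun_dual M h]
  rfl

lemma isNConnected_dual_iff [M.Finite] {k : ℕ} : M✶.IsNConnected k ↔ M.IsNConnected k := by
  simp only [IsNConnected, isSeparation_dual_iff]

/-- The connectivity function does not increase when passing to a minor. -/
lemma IsMinor.connFun_inter_le [M.Finite] (h : N ≤m M) (X : Set α) :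
    N.connFun (X ∩ N.E) ≤ M.connFun X := by
  obtain ⟨C, D, hC, hD, hCD, rfl⟩ := h.exists_eq_contract_delete_disjoint
  have hE : (M ／ C ＼ D).E = M.E \ (C ∪ D) := by simp [sdiff_sdiff]
  have h1 := M.rkNat_minor_add (C := C) (D := D) (Z := X ∩ (M ／ C ＼ D).E) inter_subset_right
  have h2 := M.rkNat_minor_add (C := C) (D := D) (Z := (M ／ C ＼ D).E \ (X ∩ (M ／ C ＼ D).E))
    sdiff_subset
  have h3 := M.rkNat_minor_add (C := C) (D := D) Subset.rfl
  rw [hE] at h1 h2 h3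
  generalize hF : M.E \ (C ∪ D) = F at *
  -- With F the ground set of the minor and C split along X, these four instances of submodularity
  -- add up to the claim.
  have s1 := M.rkNat_submod ((X ∩ F) ∪ (C ∩ X)) C
  have s2 := M.rkNat_union_le (C ∩ X) ((F \ (X ∩ F)) ∪ (C \ X))
  have s3 := M.rkNat_submod (X ∩ M.E) (F ∪ C)
  have s4 := M.rkNat_submod (M.E \ X) ((X ∩ M.E) ∪ F ∪ C)
  rw [show (X ∩ F ∪ C ∩ X) ∩ C = C ∩ X by grind,
    show (X ∩ F ∪ C ∩ X) ∪ C = X ∩ F ∪ C by grind] at s1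
  rw [show C ∩ X ∪ (F \ (X ∩ F) ∪ C \ X) = F \ (X ∩ F) ∪ C by grind] at s2
  rw [show X ∩ M.E ∩ (F ∪ C) = X ∩ F ∪ C ∩ X by grind,
    show X ∩ M.E ∪ (F ∪ C) = X ∩ M.E ∪ F ∪ C by grind, M.rkNat_inter_ground X] at s3
  rw [show M.E \ X ∩ (X ∩ M.E ∪ F ∪ C) = F \ (X ∩ F) ∪ C \ X by grind,
    show M.E \ X ∪ (X ∩ M.E ∪ F ∪ C) = M.E by grind] at s4
  simp only [connFun, hE]
  omega

lemma IsNConnected.le_connFun {n k : ℕ} (hM : M.IsNConnected n) (hk : k < n) (hX : X ⊆ M.E)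
    (h1 : k ≤ X.encard) (h2 : k ≤ (M.E \ X).encard) : k ≤ M.connFun X := by
  by_contra! h
  exact hM k hk X ⟨hX, h, h1, h2⟩

/-- The working form of 3-connectivity: λ ≥ 2 as an inequality of natural numbers, ready to be added
to submodularity. -/
lemma IsNConnected.add_two_le (hM : M.IsNConnected 3) (hX : X ⊆ M.E) (h1 : X.Nontrivial)
    (h2 : (M.E \ X).Nontrivial) : M.rkNat M.E + 2 ≤ M.rkSum X := by
  have := hM.le_connFun (k := 2) (by simp) hX
    (by exact_mod_cast two_le_encard_iff_nontrivial.2 h1)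
    (by exact_mod_cast two_le_encard_iff_nontrivial.2 h2)
  rw [connFun_eq] at this
  push_cast at this
  omega

lemma IsNConnected.add_one_le (hM : M.IsNConnected 3) (hX : X ⊆ M.E) (h1 : X.Nonempty)
    (h2 : (M.E \ X).Nonempty) : M.rkNat M.E + 1 ≤ M.rkSum X := by
  have := hM.le_connFun (k := 1) (by simp) hX
    (by exact_mod_cast one_le_encard_iff_nonempty.2 h1)
    (by exact_mod_cast one_le_encard_iff_nonempty.2 h2)
  rw [connFun_eq] at this
  push_cast at this
  omega

lemma IsNConnected.rkNat_singleton [M.Finite] (hM : M.IsNConnected 3) (hE : M.E.Nontrivial)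
    (he : e ∈ M.E) : M.rkNat {e} = 1 := by
  have h := hM.add_one_le (X := {e}) (by simpa) (by simp)
    (by obtain ⟨f, hf, hne⟩ := hE.exists_ne e; exact ⟨f, hf, hne⟩)
  have h1 := M.rkNat_le_ground (M.E \ {e})
  have h2 := M.rkNat_singleton_le e
  simp only [rkSum] at h
  omega

lemma nontrivial_diff_pair (hE : 4 ≤ X.encard) (e f : α) : (X \ {e, f}).Nontrivial := by
  rw [← two_le_encard_iff_nontrivial]
  have h := X.encard_le_encard_sdiff_add_encard {e, f}
  have h2 : ({e, f} : Set α).encard ≤ 2 := by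
    refine (encard_insert_le {f} e).trans ?_
    rw [encard_singleton]; norm_num
  have h3 : (4 : ℕ∞) ≤ (X \ {e, f}).encard + 2 := hE.trans (h.trans (by gcongr))
  have h4 : (2 : ℕ∞) + 2 ≤ (X \ {e, f}).encard + 2 := by
    refine le_trans (by norm_num) h3
  exact (ENat.add_le_add_iff_right (by simp)).1 h4

lemma IsNConnected.rkNat_pair [M.Finite] (hM : M.IsNConnected 3) (hE : 4 ≤ M.E.encard)
    (he : e ∈ M.E) (hf : f ∈ M.E) (hne : e ≠ f) : M.rkNat {e, f} = 2 := by
  have h := hM.add_two_le (X := {e, f}) (pair_subset he hf) (nontrivial_pair hne)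
    (nontrivial_diff_pair hE e f)
  have h1 := M.rkNat_le_ground (M.E \ {e, f})
  have h2 := M.rkNat_pair_le e f
  simp only [rkSum] at h
  omega

lemma IsNConnected.rkNat_diff_singleton [M.Finite] (hM : M.IsNConnected 3) (hE : M.E.Nontrivial)
    (he : e ∈ M.E) : M.rkNat (M.E \ {e}) = M.rkNat M.E := by
  have h := hM.add_one_le (X := {e}) (by simpa) (by simp)
    (by obtain ⟨f, hf, hne⟩ := hE.exists_ne e; exact ⟨f, hf, hne⟩)
  have h1 := M.rkNat_le_ground (M.E \ {e})
  have h2 := M.rkNat_singleton_le e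
  simp only [rkSum] at h
  omega

end Conn

end Matroid

namespace Matroid

variable {α β γ : Type*} {M N : Matroid α} {X Y Z C D : Set α} {e f x s : α}

/-! ### Isomorphism of matroids. -/

section Iso

lemma isIsomorphic_of_bijOn {M : Matroid α} {N : Matroid β} (f : α → β) (hf : BijOn f M.E N.E)
    (h : ∀ I ⊆ M.E, M.Indep I ↔ N.Indep (f '' I)) : M.IsIsomorphic N := by
  refine ⟨hf.equiv, fun I ↦ ?_⟩
  rw [h _ (by simp), image_image, image_image]
  rfl

lemma IsIsomorphic.symm {M : Matroid α} {N : Matroid β} (h : M.IsIsomorphic N) :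
    N.IsIsomorphic M := by
  obtain ⟨e, h⟩ := h
  refine ⟨e.symm, fun I ↦ ?_⟩
  rw [h, e.image_symm_image]

lemma IsIsomorphic.trans {M : Matroid α} {N : Matroid β} {P : Matroid γ} (h : M.IsIsomorphic N)
    (h' : N.IsIsomorphic P) : M.IsIsomorphic P := by
  obtain ⟨e, h⟩ := h
  obtain ⟨e', h'⟩ := h'
  refine ⟨e.trans e', fun I ↦ ?_⟩
  rw [h, h', ← image_comp e' e]
  rfl

lemma eRk_le_of_forall_indep_iff {M : Matroid α} {N : Matroid β} (e : M.E ≃ N.E)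
    (h : ∀ I : Set M.E, M.Indep (Subtype.val '' I) ↔ N.Indep (Subtype.val '' (e '' I)))
    (I : Set M.E) : M.eRk (Subtype.val '' I) ≤ N.eRk (Subtype.val '' (e '' I)) := by
  rw [eRk_le_iff]
  intro J hJI hJ
  obtain ⟨J, hJI', rfl⟩ := subset_image_iff.1 hJI
  rw [h] at hJ
  refine le_trans (le_of_eq ?_) (hJ.encard_le_eRk_of_subset (image_mono (image_mono hJI')))
  rw [Subtype.val_injective.encard_image, Subtype.val_injective.encard_image,
    e.injective.encard_image]

lemma eRk_eq_of_forall_indep_iff {M : Matroid α} {N : Matroid β} (e : M.E ≃ N.E)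
    (h : ∀ I : Set M.E, M.Indep (Subtype.val '' I) ↔ N.Indep (Subtype.val '' (e '' I)))
    (I : Set M.E) : M.eRk (Subtype.val '' I) = N.eRk (Subtype.val '' (e '' I)) := by
  refine (eRk_le_of_forall_indep_iff e h I).antisymm ?_
  have := eRk_le_of_forall_indep_iff e.symm (fun I ↦ by rw [h, e.image_symm_image]) (e '' I)
  rwa [e.symm_image_image] at this

lemma ground_diff_image_val (M : Matroid α) (I : Set M.E) :
    M.E \ (Subtype.val '' I) = Subtype.val '' Iᶜ := by
  ext; simp +contextual

lemma IsIsomorphic.isNConnected {M : Matroid α} {N : Matroid β} {n : ℕ} (h : M.IsIsomorphic N)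
    (hN : N.IsNConnected n) : M.IsNConnected n := by
  obtain ⟨e, h⟩ := h
  have hr : ∀ I : Set M.E, M.rkNat (Subtype.val '' I) = N.rkNat (Subtype.val '' (e '' I)) :=
    fun I ↦ by rw [rkNat, rkNat, eRk_eq_of_forall_indep_iff e h]
  rintro k hk X ⟨hXE, hX, h1, h2⟩
  obtain ⟨I, rfl⟩ : ∃ I : Set M.E, X = Subtype.val '' I :=
    ⟨Subtype.val ⁻¹' X, by simpa using hXE⟩
  have hE : M.rkNat M.E = N.rkNat N.E := by
    have := hr univ
    rwa [image_univ, image_univ, e.range_eq_univ, image_univ, Subtype.range_coe,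
      Subtype.range_coe] at this
  refine hN k hk (Subtype.val '' (e '' I)) ⟨by simp, ?_, ?_, ?_⟩
  · rwa [connFun, ground_diff_image_val, hr, hr, hE, image_compl_eq e.bijective,
      ← ground_diff_image_val] at hX
  · rwa [Subtype.val_injective.encard_image, e.injective.encard_image,
      ← Subtype.val_injective.encard_image]
  · rwa [ground_diff_image_val, ← image_compl_eq e.bijective, Subtype.val_injective.encard_image,
      e.injective.encard_image, ← Subtype.val_injective.encard_image, ← ground_diff_image_val]

lemma IsIsomorphic.encard_ground {M : Matroid α} {N : Matroid β} (h : M.IsIsomorphic N) :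
    M.E.encard = N.E.encard := by
  obtain ⟨e, h⟩ := h
  exact encard_congr e

lemma dual_indep_iff_eRk [M.Finite] (hX : X ⊆ M.E) :
    M✶.Indep X ↔ M.eRk M.E ≤ M.eRk (M.E \ X) := by
  rw [← coindep_def, coindep_iff_compl_spanning, spanning_iff_eRk_le, eRk_ground]

lemma IsIsomorphic.dual {M : Matroid α} {N : Matroid β} [M.Finite] [N.Finite]
    (h : M.IsIsomorphic N) : M✶.IsIsomorphic N✶ := by
  obtain ⟨e, h⟩ := h
  refine ⟨e, fun (I : Set M.E) ↦ ?_⟩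
  have hE := eRk_eq_of_forall_indep_iff e h univ
  rw [image_univ, image_univ, e.range_eq_univ, image_univ, Subtype.range_coe,
      Subtype.range_coe] at hE
  have h1 := eRk_eq_of_forall_indep_iff e h (Iᶜ : Set M.E)
  rw [image_compl_eq (s := (I : Set M.E)) e.bijective] at h1
  change M✶.Indep (Subtype.val '' I) ↔ N✶.Indep (Subtype.val '' (e '' I) : Set β)
  rw [dual_indep_iff_eRk (M := M) (by simp), dual_indep_iff_eRk (M := N) (by simp), hE,
    ground_diff_image_val, ground_diff_image_val, h1]

end Iso

/-! ### Simplification and cosimplification; survival of 3-connected minors. -/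

section Simplification

lemma parallelClass_nonempty (he : M.IsNonloop e) : (M.parallelClass e).Nonempty :=
  ⟨e, M.mem_closure_self e he.mem_ground, he.not_isLoop⟩

lemma parallelRep_mem (he : M.IsNonloop e) : M.parallelRep e ∈ M.closure {e} \ M.loops := by
  rw [parallelRep, dif_pos (parallelClass_nonempty he)]
  exact (parallelClass_nonempty he).some_mem

lemma isNonloop_parallelRep (he : M.IsNonloop e) : M.IsNonloop (M.parallelRep e) := by
  have := parallelRep_mem he
  exact ⟨this.2, M.closure_subset_ground _ this.1⟩

lemma parallelRep_of_not_isNonloop (he : ¬ M.IsNonloop e) : M.parallelRep e = e := by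
  rw [not_isNonloop_iff_closure] at he
  rw [parallelRep, dif_neg]
  simp [parallelClass, he]

@[simp] lemma closure_parallelRep (M : Matroid α) (e : α) :
    M.closure {M.parallelRep e} = M.closure {e} := by
  by_cases he : M.IsNonloop e
  · exact (isNonloop_parallelRep he).closure_eq_of_mem_closure (parallelRep_mem he).1
  rw [parallelRep_of_not_isNonloop he]

lemma parallelRep_congr (he : M.IsNonloop e) (h : M.closure {e} = M.closure {f}) :
    M.parallelRep e = M.parallelRep f := by
  have h' : M.parallelClass e = M.parallelClass f := by rw [parallelClass, parallelClass, h]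
  have h1 := parallelClass_nonempty he
  have h2 := h1
  rw [h'] at h2
  rw [parallelRep, parallelRep, dif_pos h1, dif_pos h2]
  congr!

lemma parallelRep_mem_si (he : M.IsNonloop e) : M.parallelRep e ∈ M.si.E := ⟨e, he, rfl⟩

lemma isNonloop_of_mem_si (he : e ∈ M.si.E) : M.IsNonloop e := by
  obtain ⟨f, hf, rfl⟩ := he
  exact isNonloop_parallelRep hf

lemma parallelRep_of_mem_si (he : e ∈ M.si.E) : M.parallelRep e = e := by
  obtain ⟨f, hf, rfl⟩ := he
  exact parallelRep_congr (isNonloop_parallelRep hf) (by simp)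

lemma si_ground_subset (M : Matroid α) : M.si.E ⊆ M.E := fun _ h ↦ (isNonloop_of_mem_si h).mem_ground

lemma si_isRestriction (M : Matroid α) : M.si ≤r M := ⟨_, M.si_ground_subset, rfl⟩

lemma si_isMinor (M : Matroid α) : M.si ≤m M := by
  obtain ⟨R, hR, h⟩ := M.si_isRestriction
  exact ⟨∅, M.E \ R, by rw [contract_empty, delete_compl hR, h]⟩

instance si_finite [M.Finite] : M.si.Finite := M.si_isMinor.finite'

lemma rkNat_si (h : X ⊆ M.si.E) : M.si.rkNat X = M.rkNat X := M.rkNat_restrict h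

lemma subset_closure_image_parallelRep (M : Matroid α) (hX : X ⊆ M.E) :
    X ⊆ M.closure (M.parallelRep '' X) := by
  intro e he
  have := M.mem_closure_self e (hX he)
  rw [← closure_parallelRep] at this
  exact M.closure_subset_closure (by simpa using ⟨e, he, rfl⟩) this

lemma rkNat_image_parallelRep (M : Matroid α) [M.Finite] (hX : X ⊆ M.E) :
    M.rkNat (M.parallelRep '' X) = M.rkNat X := by
  have hE : M.parallelRep '' X ⊆ M.E := by
    rintro _ ⟨e, he, rfl⟩
    by_cases h : M.IsNonloop e
    · exact (isNonloop_parallelRep h).mem_ground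
    rw [parallelRep_of_not_isNonloop h]; exact hX he
  refine le_antisymm ?_ ?_
  · rw [← M.rkNat_closure X]
    refine M.rkNat_mono ?_
    rintro _ ⟨e, he, rfl⟩
    have := M.mem_closure_self _ (hE ⟨e, he, rfl⟩)
    rw [closure_parallelRep] at this
    exact M.closure_subset_closure (by simpa) this
  · rw [← M.rkNat_closure (M.parallelRep '' X)]
    exact M.rkNat_mono (M.subset_closure_image_parallelRep hX)

/-- Every set in `si(M)` expands to a union of parallel classes of `M` with the same
connectivity. -/
lemma exists_expand_si [M.Finite] {U : Set α} (hU : U ⊆ M.si.E) :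
    ∃ P ⊆ M.E, P ∩ M.si.E = U ∧ M.connFun P = M.si.connFun U ∧
      ∀ e f, M.IsNonloop e → M.closure {e} = M.closure {f} → (e ∈ P ↔ f ∈ P) := by
  have hUP : ∀ e ∈ M.si.E, e ∈ M.E ∧ M.parallelRep e = e :=
    fun e he ↦ ⟨M.si_ground_subset he, parallelRep_of_mem_si he⟩
  refine ⟨{e | e ∈ M.E ∧ M.parallelRep e ∈ U}, fun _ h ↦ h.1, ?_, ?_, fun e f he hef ↦ ?_⟩
  · ext e
    simp only [mem_inter_iff, mem_ofPred_eq]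
    constructor
    · rintro ⟨⟨-, h⟩, h'⟩
      rwa [(hUP e h').2] at h
    · intro h
      rw [(hUP e (hU h)).2]
      exact ⟨⟨(hUP e (hU h)).1, h⟩, hU h⟩
  · have h1 : M.rkNat {e | e ∈ M.E ∧ M.parallelRep e ∈ U} = M.rkNat U := by
      refine rkNat_eq_of_subset_closure (fun e he ↦ ?_) ?_
      · rw [mem_ofPred_eq, (hUP e (hU he)).2]
        exact ⟨(hUP e (hU he)).1, he⟩
      · rintro e ⟨he, heU⟩
        have := M.mem_closure_self e he
        rw [← closure_parallelRep] at this
        exact M.closure_subset_closure (by simpa) this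
    have h2 : M.rkNat (M.E \ {e | e ∈ M.E ∧ M.parallelRep e ∈ U}) = M.rkNat (M.si.E \ U) := by
      refine rkNat_eq_of_subset_closure (fun e he ↦ ⟨(hUP e he.1).1, fun h ↦ ?_⟩) ?_
      · rw [mem_ofPred_eq, (hUP e he.1).2] at h
        exact he.2 h.2
      · rintro e ⟨he, heU⟩
        by_cases hl : M.IsNonloop e
        · have := M.mem_closure_self e he
          rw [← closure_parallelRep] at this
          have h' : M.parallelRep e ∈ M.si.E \ U := ⟨parallelRep_mem_si hl, fun h ↦ heU ⟨he, h⟩⟩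
          exact M.closure_subset_closure (singleton_subset_iff.2 h') this
        rw [not_isNonloop_iff] at hl
        exact hl.mem_closure _
    have h3 : M.rkNat M.E = M.rkNat M.si.E := by
      refine rkNat_eq_of_subset_closure M.si_ground_subset (fun e he ↦ ?_)
      by_cases hl : M.IsNonloop e
      · have := M.mem_closure_self e he
        rw [← closure_parallelRep] at this
        exact M.closure_subset_closure (singleton_subset_iff.2 (parallelRep_mem_si hl)) this
      rw [not_isNonloop_iff] at hl
      exact hl.mem_closure _
    rw [connFun, connFun, h1, h2, h3, rkNat_si hU, rkNat_si sdiff_subset, rkNat_si Subset.rfl]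
  · have hf : M.IsNonloop f := by
      by_contra hf
      rw [not_isNonloop_iff_closure, ← hef, ← not_isNonloop_iff_closure] at hf
      exact hf he
    simp [he.mem_ground, hf.mem_ground, parallelRep_congr he hef]

/-- Every set in `co(M)` expands to a union of series classes of `M` with the same
connectivity. -/
lemma exists_expand_co [M.Finite] {U : Set α} (hU : U ⊆ M.co.E) :
    ∃ P ⊆ M.E, P ∩ M.co.E = U ∧ M.connFun P = M.co.connFun U ∧
      ∀ e f, M✶.IsNonloop e → M✶.closure {e} = M✶.closure {f} → (e ∈ P ↔ f ∈ P) := by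
  obtain ⟨P, hP, h1, h2, h3⟩ := exists_expand_si (M := M✶) (U := U) hU
  refine ⟨P, hP, h1, ?_, h3⟩
  rw [connFun_dual M hP] at h2
  rw [h2, co, connFun_dual M✶.si hU]

/-- A 3-connected N = M/C\D with at least four elements has no loops or parallel pairs, so its
elements avoid cl(C) and lie in distinct parallel classes of M. Replacing every element of N and
every nonloop of C by its representative changes no rank, and the result is a minor of si(M). -/
lemma IsMinor.exists_isIsomorphic_si [M.Finite] (hNM : N ≤m M) (hN : N.IsNConnected 3)
    (hcard : 4 ≤ N.E.encard) : ∃ N', N' ≤m M.si ∧ N.IsIsomorphic N' := by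
  have hfin := hNM.finite'
  obtain ⟨C, D, hC, hD, hCD, rfl⟩ := hNM.exists_eq_contract_delete_disjoint
  set N := M ／ C ＼ D with hNdef
  have hnt : N.E.Nontrivial := by
    rw [← two_le_encard_iff_nontrivial]
    exact le_trans (by norm_num) hcard
  have hNE : ∀ e ∈ N.E, e ∈ M.E ∧ e ∉ C := fun e he ↦ ⟨he.1.1, he.1.2⟩
  have hcl : ∀ e ∈ N.E, e ∉ M.closure C := by
    intro e he hec
    have h1 := M.rkNat_minor_add (C := C) (D := D) (Z := {e})
      (singleton_subset_iff.2 he)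
    have h2 := hN.rkNat_singleton hnt he
    rw [singleton_union, rkNat_insert_of_mem_closure hec] at h1
    rw [hNdef] at h2
    omega
  have hnl : ∀ e ∈ N.E, M.IsNonloop e := fun e he ↦
    isNonloop_of_notMem_closure (hcl e he) (hNE e he).1
  have hinj : InjOn M.parallelRep N.E := by
    intro e he f hf hef
    by_contra hne
    have h1 := M.rkNat_minor_add (C := C) (D := D) (Z := {e, f}) (pair_subset he hf)
    have h2 := hN.rkNat_pair hcard he hf hne
    have h3 : e ∈ M.closure ({f} ∪ C) := by
      have := M.mem_closure_self e (hNE e he).1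
      rw [← closure_parallelRep, hef, closure_parallelRep] at this
      exact M.closure_subset_closure subset_union_left this
    have h4 := M.rkNat_union_le {f} C
    have h5 := M.rkNat_singleton_le f
    rw [insert_union, rkNat_insert_of_mem_closure h3] at h1
    rw [hNdef] at h2
    omega
  set C' := M.parallelRep '' (C ∩ {e | M.IsNonloop e}) with hC'
  set S := M.parallelRep '' N.E with hS
  have hSsi : S ⊆ M.si.E := image_mono fun e he ↦ hnl e he
  have hCsi : C' ⊆ M.si.E := image_mono fun e he ↦ he.2
  have hdj : Disjoint S C' := by
    rw [disjoint_left]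
    rintro _ ⟨e, he, rfl⟩ ⟨c, hc, hce⟩
    refine hcl e he ?_
    have := M.mem_closure_self e (hNE e he).1
    rw [← closure_parallelRep, ← hce, closure_parallelRep] at this
    exact M.closure_subset_closure (singleton_subset_iff.2 hc.1) this
  have hC1 : M.closure (C ∩ {e | M.IsNonloop e}) = M.closure C :=
    M.closure_inter_setOfPred_isNonloop_eq C
  have hfinS : S.Finite := M.si.ground_finite.subset hSsi
  refine ⟨M.si ／ C' ＼ (M.si.E \ (C' ∪ S)), contract_delete_isMinor .., ?_⟩
  have hE' : (M.si ／ C' ＼ (M.si.E \ (C' ∪ S))).E = S := by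
    rw [delete_ground, contract_ground]
    rw [disjoint_left] at hdj
    grind
  refine isIsomorphic_of_bijOn M.parallelRep (by rw [hE']; exact hinj.bijOn_image) ?_
  intro I hI
  have hIS : M.parallelRep '' I ⊆ S := image_mono hI
  have hIfin : I.Finite := N.ground_finite.subset hI
  rw [indep_iff_rkNat hIfin, indep_iff_rkNat (hIfin.image _), (hinj.mono hI).ncard_image]
  have h1 := M.rkNat_minor_add (C := C) (D := D) hI
  have h2 := M.si.rkNat_minor_add (C := C') (Z := M.parallelRep '' I) (D := M.si.E \ (C' ∪ S))
    (by rwa [hE'])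
  have h3 : M.rkNat C' = M.rkNat C := by
    rw [hC', M.rkNat_image_parallelRep (inter_subset_left.trans hC), ← M.rkNat_closure (C ∩ _), hC1,
      rkNat_closure]
  have h4 : M.rkNat (M.parallelRep '' I ∪ C') = M.rkNat (I ∪ C) := by
    rw [hC', ← image_union, M.rkNat_image_parallelRep (union_subset
      (fun e he ↦ (hNE e (hI he)).1) (inter_subset_left.trans hC)), ← M.rkNat_closure (I ∪ _),
      ← closure_union_closure_right_eq, hC1, closure_union_closure_right_eq, rkNat_closure]
  rw [rkNat_si hCsi, rkNat_si (union_subset (hIS.trans hSsi) hCsi), h3, h4] at h2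
  change N.rkNat I + _ = _ at h1
  set N' := M.si ／ C' ＼ (M.si.E \ (C' ∪ S))
  change N.rkNat I = _ ↔ N'.rkNat _ = _
  omega

lemma IsMinor.dual (h : N ≤m M) : N✶ ≤m M✶ := by
  obtain ⟨C, D, hC, hD, hCD, rfl⟩ := h.exists_eq_contract_delete_disjoint
  rw [dual_contract_delete, ← contract_delete_comm _ hCD.symm]
  exact contract_delete_isMinor ..

lemma IsMinor.exists_isIsomorphic_co [M.Finite] (hNM : N ≤m M) (hN : N.IsNConnected 3)
    (hcard : 4 ≤ N.E.encard) : ∃ N', N' ≤m M.co ∧ N.IsIsomorphic N' := by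
  have hfin := hNM.finite'
  obtain ⟨N', hN', hiso⟩ := hNM.dual.exists_isIsomorphic_si (isNConnected_dual_iff.2 hN) hcard
  have hfin' := hN'.finite'
  refine ⟨N'✶, hN'.dual, ?_⟩
  simpa using hiso.dual

end Simplification

end Matroid

namespace Matroid

variable {α : Type*} {M N : Matroid α} {X Y Z C D W W₁ W₂ : Set α} {e f x s : α}

/-! ### Moving a minor across a 2-separation. -/

section TwoSeparation

lemma rkNat_contractElem_add_one [M.Finite] (hx : M.rkNat {x} = 1) (hZ : Z ⊆ M.E \ {x}) :
    (M ／ {x}).rkNat Z + 1 = M.rkNat (insert x Z) := by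
  rw [← hx, rkNat_contract_add _ hZ, union_singleton]

/-- If `W₁, W₂ ⊆ X` have the same local connectivity with the other side `Y` of a `2`-separation,
then contracting them has the same effect on subsets of `Y`. -/
lemma rkNat_union_exchange [M.Finite] (hU : X ∪ Y = M.E) (hd : Disjoint X Y)
    (hr : M.rkNat X + M.rkNat Y ≤ M.rkNat M.E + 1) (h₁ : W₁ ⊆ X) (h₂ : W₂ ⊆ X)
    (h : M.rkNat (W₁ ∪ Y) + M.rkNat W₂ = M.rkNat (W₂ ∪ Y) + M.rkNat W₁) (hZ : Z ⊆ Y) :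
    M.rkNat (Z ∪ W₁) + M.rkNat W₂ = M.rkNat (Z ∪ W₂) + M.rkNat W₁ := by
  have hd' := disjoint_left.1 hd
  -- The local connectivity r(W) + r(Y) - r(W ∪ Y) is 0 or 1. If it is 0, W is skew to Z; if it is
  -- 1, W acts on Z exactly as the whole of X does.
  have key : ∀ W ⊆ X, (M.rkNat (W ∪ Y) = M.rkNat W + M.rkNat Y ∧
      M.rkNat (Z ∪ W) = M.rkNat Z + M.rkNat W) ∨
      (M.rkNat (W ∪ Y) + 1 = M.rkNat W + M.rkNat Y ∧
      M.rkNat (Z ∪ W) + M.rkNat X = M.rkNat (Z ∪ X) + M.rkNat W) := by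
    intro W hW
    have s1 := M.rkNat_union_le W Y
    have s2 := M.rkNat_submod X (W ∪ Y)
    have s3 := M.rkNat_union_le Z W
    have s4 := M.rkNat_submod (Z ∪ W) Y
    have s5 := M.rkNat_submod (Z ∪ W) X
    have s6 := M.rkNat_submod (Z ∪ X) (W ∪ Y)
    rw [show X ∩ (W ∪ Y) = W by grind, show X ∪ (W ∪ Y) = M.E by grind] at s2
    rw [show (Z ∪ W) ∩ Y = Z by grind, show Z ∪ W ∪ Y = W ∪ Y by grind] at s4
    rw [show (Z ∪ W) ∩ X = W by grind, show Z ∪ W ∪ X = Z ∪ X by grind] at s5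
    rw [show (Z ∪ X) ∩ (W ∪ Y) = Z ∪ W by grind, show Z ∪ X ∪ (W ∪ Y) = M.E by grind] at s6
    omega
  have k1 := key W₁ h₁
  have k2 := key W₂ h₂
  omega

/-- If `(X, Y)` is a `2`-separation and a `3`-connected minor has at most one element in `X`,
then contracting an element of `X` that is not spanned by `Y` keeps the minor. -/
lemma IsMinor.exists_isIsomorphic_contract [M.Finite] (hNM : N ≤m M) (hN : N.IsNConnected 3)
    (hcard : 4 ≤ N.E.encard) (hU : X ∪ Y = M.E) (hd : Disjoint X Y)
    (hr : M.rkNat X + M.rkNat Y = M.rkNat M.E + 1) (hX : (X ∩ N.E).Subsingleton)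
    (hs : s ∈ X) (hsY : s ∉ M.closure Y) :
    ∃ N', N' ≤m M ／ {s} ∧ N.IsIsomorphic N' ∧ (X ∩ N'.E).Subsingleton := by
  have hd' := disjoint_left.1 hd
  have hnt : N.E.Nontrivial := by
    rw [← two_le_encard_iff_nontrivial]
    exact le_trans (by norm_num) hcard
  have hfinN := hNM.finite'
  obtain ⟨C, D, hC, hD, hCD, rfl⟩ := hNM.exists_eq_contract_delete_disjoint
  have hsE : s ∈ M.E := by rw [← hU]; exact Or.inl hs
  have hsr : M.rkNat {s} = 1 ∧ M.rkNat ({s} ∪ Y) = M.rkNat Y + 1 := by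
    have h1 := rkNat_insert_of_notMem_closure hsE hsY
    have h2 := M.rkNat_singleton_le s
    have h3 := M.rkNat_union_le {s} Y
    rw [singleton_union] at h3 ⊢
    omega
  have hminor : ∀ W D', s ∈ W → M ／ W ＼ D' ≤m M ／ {s} := fun W D' hW ↦
    ⟨W, D', by rw [contract_contract, union_eq_self_of_subset_left (singleton_subset_iff.2 hW)]⟩
  have hloc : ∀ W ⊆ X, M.rkNat (W ∪ Y) = M.rkNat W + M.rkNat Y ∨
      M.rkNat (W ∪ Y) + 1 = M.rkNat W + M.rkNat Y := by
    intro W hW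
    have s1 := M.rkNat_union_le W Y
    have s2 := M.rkNat_submod X (W ∪ Y)
    rw [show X ∩ (W ∪ Y) = W by clear * - hW hd'; grind,
      show X ∪ (W ∪ Y) = M.E by clear * - hU hW; grind] at s2
    omega
  have hrk := fun (Z : Set α) (hZ : Z ⊆ (M ／ C ＼ D).E) ↦ M.rkNat_minor_add hZ
  set N := M ／ C ＼ D with hNdef
  have hNE : N.E = (M.E \ C) \ D := rfl
  have hCs : (C ∩ Y) ∪ (C ∩ X) = C := by clear * - hC hU; grind
  have exch := fun (W W' Z : Set α) (hW : W ⊆ X) (hW' : W' ⊆ X) h (hZ : Z ⊆ Y) ↦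
    M.rkNat_union_exchange hU hd hr.le hW hW' h hZ
  obtain hX0 | ⟨e, hXe⟩ := hX.eq_empty_or_singleton
  · obtain ⟨W, hWX, hsW, hW⟩ : ∃ W ⊆ X, s ∈ W ∧
        M.rkNat (C ∩ X ∪ Y) + M.rkNat W = M.rkNat (W ∪ Y) + M.rkNat (C ∩ X) := by
      obtain h | h := hloc (C ∩ X) inter_subset_right
      · exact ⟨{s}, by simpa, rfl, by omega⟩
      · exact ⟨X, Subset.rfl, hs, by rw [hU]; omega⟩
    have hNY : N.E ⊆ Y := by
      intro z hz
      have hzE : z ∈ M.E := hz.1.1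
      rw [← hU] at hzE
      exact hzE.resolve_left fun h ↦ (hX0.subset ⟨h, hz⟩).elim
    have hNC : ∀ z ∈ N.E, z ∈ M.E ∧ z ∉ C := fun z hz ↦ ⟨hz.1.1, hz.1.2⟩
    set D' := M.E \ (W ∪ (C ∩ Y) ∪ N.E) with hD'
    have hE' : (M ／ (W ∪ (C ∩ Y)) ＼ D').E = N.E := by
      rw [delete_ground, contract_ground, hD']
      clear_value N
      clear * - hWX hNY hd' hNC
      grind
    refine ⟨M ／ (W ∪ (C ∩ Y)) ＼ D', hminor _ _ (Or.inl hsW), ?_, ?_⟩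
    · refine isIsomorphic_of_bijOn id (by rw [hE']; exact bijOn_id _) fun I hI ↦ ?_
      have hIfin : I.Finite := N.ground_finite.subset hI
      rw [image_id, indep_iff_rkNat hIfin, indep_iff_rkNat hIfin]
      have h1 := hrk I hI
      have h2 := M.rkNat_minor_add (Z := I) (C := W ∪ (C ∩ Y)) (D := D') (by rwa [hE'])
      have e1 := exch _ _ (C ∩ Y) inter_subset_right hWX hW inter_subset_right
      have e2 := exch _ _ (I ∪ (C ∩ Y)) inter_subset_right hWX hW
        (union_subset (hI.trans hNY) inter_subset_right)
      rw [hCs] at e1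
      rw [union_assoc, hCs] at e2
      have h3 : M.rkNat (I ∪ (W ∪ C ∩ Y)) = M.rkNat (I ∪ C ∩ Y ∪ W) := by
        rw [union_comm W, ← union_assoc]
      have h4 : M.rkNat (W ∪ C ∩ Y) = M.rkNat (C ∩ Y ∪ W) := by rw [union_comm W]
      omega
    · rw [hE', hX0]; exact subsingleton_empty
  have he : e ∈ X ∧ e ∈ N.E := by
    have : e ∈ X ∩ N.E := by rw [hXe]; rfl
    exact this
  have hY : ∀ z ∈ N.E, z ≠ e → z ∈ Y := by
    intro z hz hne
    have : z ∈ X → z = e := fun h ↦ by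
      have : z ∈ X ∩ N.E := ⟨h, hz⟩
      rwa [hXe] at this
    have hzE : z ∈ M.E := hz.1.1
    rw [← hU] at hzE
    exact hzE.resolve_left fun h ↦ hne (this h)
  have heC : insert e (C ∩ X) ⊆ X := insert_subset he.1 inter_subset_right
  have hdel := hN.rkNat_diff_singleton hnt he.2
  have hsing := hN.rkNat_singleton hnt he.2
  have hNEe : N.E \ {e} ⊆ Y := fun z hz ↦ hY z hz.1 hz.2
  have r1 := hrk _ Subset.rfl
  have r2 := hrk (N.E \ {e}) sdiff_subset
  have r3 := hrk {e} (singleton_subset_iff.2 he.2)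
  have heN := he.2
  have t1 : N.E ∪ C = (N.E \ {e} ∪ (C ∩ Y)) ∪ insert e (C ∩ X) := by
    clear * - hCs heN; grind
  have t2 : N.E \ {e} ∪ C = (N.E \ {e} ∪ (C ∩ Y)) ∪ (C ∩ X) := by clear * - hCs; grind
  have t3 : {e} ∪ C = (C ∩ Y) ∪ insert e (C ∩ X) := by clear * - hCs; grind
  have hZ1 : N.E \ {e} ∪ (C ∩ Y) ⊆ Y := union_subset hNEe inter_subset_right
  -- If adding e to C ∩ X left the local connectivity unchanged, the exchange lemma would make e
  -- raise the rank of C and that of (E(N) \ e) ∪ C by the same amount. But e is neither a loop nor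
  -- a coloop of N, so the amounts are 1 and 0.
  have hl1 : M.rkNat (C ∩ X ∪ Y) = M.rkNat (C ∩ X) + M.rkNat Y ∧
      M.rkNat (insert e (C ∩ X) ∪ Y) + 1 = M.rkNat (insert e (C ∩ X)) + M.rkNat Y := by
    by_contra hcon
    have hmono : M.rkNat (insert e (C ∩ X) ∪ Y) + M.rkNat (C ∩ X) ≤
        M.rkNat (insert e (C ∩ X)) + M.rkNat (C ∩ X ∪ Y) := by
      have := M.rkNat_submod (insert e (C ∩ X)) (C ∩ X ∪ Y)
      rwa [show insert e (C ∩ X) ∩ (C ∩ X ∪ Y) = C ∩ X by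
          clear * - hd' he; grind,
        show insert e (C ∩ X) ∪ (C ∩ X ∪ Y) = insert e (C ∩ X) ∪ Y by
          clear * -; grind, add_comm] at this
    have heq : M.rkNat (C ∩ X ∪ Y) + M.rkNat (insert e (C ∩ X)) =
        M.rkNat (insert e (C ∩ X) ∪ Y) + M.rkNat (C ∩ X) := by
      have a1 := hloc _ heC
      have a2 := hloc (C ∩ X) inter_subset_right
      omega
    have e1 := exch _ _ _ inter_subset_right heC heq hZ1
    have e2 := exch _ _ (C ∩ Y) inter_subset_right heC heq inter_subset_right
    rw [← t1, ← t2] at e1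
    rw [← t3, hCs] at e2
    omega
  -- The pair (W, e') is to replace (C ∩ X, e). By maximality of W, any e' ∈ X \ W raises the local
  -- connectivity to 1; such an e' exists because X itself has local connectivity 1.
  obtain ⟨W, ⟨hWX, hsW, hW⟩, hmax⟩ : ∃ W, Maximal
      (fun W ↦ W ⊆ X ∧ s ∈ W ∧ M.rkNat (W ∪ Y) = M.rkNat W + M.rkNat Y) W := by
    refine Finite.exists_maximal (s := {W | W ⊆ X ∧ s ∈ W ∧
      M.rkNat (W ∪ Y) = M.rkNat W + M.rkNat Y}) ?_ ⟨{s}, by simpa, rfl, by omega⟩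
    exact (M.ground_finite.finite_subsets).subset fun W hW ↦
      hW.1.trans (by rw [← hU]; exact subset_union_left)
  obtain ⟨e', he'X, he'W⟩ : ∃ e' ∈ X, e' ∉ W := by
    by_contra! hcon
    rw [hWX.antisymm hcon, hU] at hW
    omega
  have hl2 : M.rkNat (insert e' W ∪ Y) + 1 = M.rkNat (insert e' W) + M.rkNat Y := by
    obtain h | h := hloc (insert e' W) (insert_subset he'X hWX)
    · exact absurd (hmax ⟨insert_subset he'X hWX, Or.inr hsW, h⟩ (subset_insert _ _)
        (mem_insert _ _)) he'W
    exact h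
  have he'W' : insert e' W ⊆ X := insert_subset he'X hWX
  have hrW : M.rkNat (insert e' W) = M.rkNat W + 1 ∧
      M.rkNat (insert e (C ∩ X)) = M.rkNat (C ∩ X) + 1 := by
    have a1 := M.rkNat_insert_le e' W
    have a2 := M.rkNat_insert_le e (C ∩ X)
    have a3 := M.rkNat_mono (show W ∪ Y ⊆ insert e' W ∪ Y by clear * -; grind)
    have a4 := M.rkNat_mono (show C ∩ X ∪ Y ⊆ insert e (C ∩ X) ∪ Y by clear * -; grind)
    omega
  set E' := insert e' (N.E \ {e}) with hE'def
  set D' := M.E \ (W ∪ (C ∩ Y) ∪ E') with hD'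
  have he'Y := hd' he'X
  have he'C : e' ∉ W ∪ (C ∩ Y) := by clear * - he'W he'Y; grind
  have he'E : e' ∈ M.E := by rw [← hU]; exact Or.inl he'X
  have hE' : (M ／ (W ∪ (C ∩ Y)) ＼ D').E = E' := by
    have hNC : ∀ z ∈ N.E, z ∈ M.E ∧ z ∉ C := fun z hz ↦ ⟨hz.1.1, hz.1.2⟩
    rw [delete_ground, contract_ground]
    clear_value N
    clear * - hNC hNEe hWX hd' he'C he'E hD' hE'def
    grind
  have hW0 : M.rkNat (C ∩ X ∪ Y) + M.rkNat W = M.rkNat (W ∪ Y) + M.rkNat (C ∩ X) := by omega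
  have hW1 : M.rkNat (insert e (C ∩ X) ∪ Y) + M.rkNat (insert e' W) =
      M.rkNat (insert e' W ∪ Y) + M.rkNat (insert e (C ∩ X)) := by omega
  refine ⟨M ／ (W ∪ (C ∩ Y)) ＼ D', hminor _ _ (Or.inl hsW), ?_, ?_⟩
  · classical
    have himg : ∀ I ⊆ N.E, e ∉ I → (fun z ↦ if z = e then e' else z) '' I = I := by
      intro I hI heI
      refine (image_congr fun z hz ↦ ?_).trans (image_id I)
      rw [if_neg (by rintro rfl; exact heI hz)]; rfl
    have himg' : ∀ I ⊆ N.E, e ∈ I → (fun z ↦ if z = e then e' else z) '' I =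
        insert e' (I \ {e}) := by
      intro I hI heI
      conv_lhs => rw [← insert_sdiff_self_of_mem heI]
      rw [image_insert_eq, himg _ (sdiff_subset.trans hI) (by simp), if_pos rfl]
    refine isIsomorphic_of_bijOn (fun z ↦ if z = e then e' else z) ?_ fun I hI ↦ ?_
    · rw [hE', hE'def, ← himg' _ Subset.rfl he.2]
      refine InjOn.bijOn_image fun a ha b hb hab ↦ ?_
      have h1 := hY a ha
      have h2 := hY b hb
      clear * - hab h1 h2 he'Y; split_ifs at hab with h3 h4 h4 <;> grind
    have hIfin : I.Finite := N.ground_finite.subset hI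
    have e1 := exch _ _ (C ∩ Y) inter_subset_right hWX hW0 inter_subset_right
    rw [hCs] at e1
    by_cases heI : e ∈ I
    · rw [himg' I hI heI]
      have hcard : (insert e' (I \ {e})).ncard = I.ncard := by
        rw [ncard_insert_of_notMem _ hIfin.sdiff, ncard_sdiff_singleton_add_one heI hIfin]
        intro h
        exact he'Y (hNEe ⟨hI h.1, h.2⟩)
      rw [indep_iff_rkNat hIfin, indep_iff_rkNat (hIfin.sdiff.insert _), hcard]
      have h1 := hrk I hI
      have h2 := M.rkNat_minor_add (Z := insert e' (I \ {e})) (C := W ∪ (C ∩ Y)) (D := D')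
        (by rw [hE']; exact insert_subset_insert (sdiff_subset_sdiff_left hI))
      have e2 := exch _ _ (I \ {e} ∪ (C ∩ Y)) heC he'W' hW1
        (union_subset ((sdiff_subset_sdiff_left hI).trans hNEe) inter_subset_right)
      rw [show I ∪ C = I \ {e} ∪ C ∩ Y ∪ insert e (C ∩ X) by
        clear * - hCs heI; grind] at h1
      rw [show insert e' (I \ {e}) ∪ (W ∪ C ∩ Y) = I \ {e} ∪ C ∩ Y ∪ insert e' W by
        clear * -; grind] at h2
      have h4 : M.rkNat (W ∪ C ∩ Y) = M.rkNat (C ∩ Y ∪ W) := by rw [union_comm W]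
      omega
    · rw [himg I hI heI, indep_iff_rkNat hIfin, indep_iff_rkNat hIfin]
      have hIY : I ⊆ Y := fun z hz ↦ hY z (hI hz) (by rintro rfl; exact heI hz)
      have h1 := hrk I hI
      have h2 := M.rkNat_minor_add (Z := I) (C := W ∪ (C ∩ Y)) (D := D')
        (by rw [hE']; exact fun z hz ↦ Or.inr ⟨hI hz, by rintro rfl; exact heI hz⟩)
      have e2 := exch _ _ (I ∪ (C ∩ Y)) inter_subset_right hWX hW0
        (union_subset hIY inter_subset_right)
      rw [union_assoc, hCs] at e2
      have h3 : M.rkNat (I ∪ (W ∪ C ∩ Y)) = M.rkNat (I ∪ C ∩ Y ∪ W) := by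
        rw [union_comm W, ← union_assoc]
      have h4 : M.rkNat (W ∪ C ∩ Y) = M.rkNat (C ∩ Y ∪ W) := by rw [union_comm W]
      omega
  · rw [hE', hE'def]
    intro a ha b hb
    have : ∀ z ∈ X ∩ insert e' (N.E \ {e}), z = e' := by
      rintro z ⟨hz, rfl | hz'⟩
      · rfl
      exact absurd (hNEe hz') (hd' hz)
    rw [this a ha, this b hb]

end TwoSeparation

end Matroid

namespace Matroid

variable {α : Type*} {M N : Matroid α} {X Y Z C D W : Set α} {e f x s : α}

/-! ### Vertical 3-separations. -/

section VertSep

/-- `(X, x, Y)` is a vertical `3`-separation: `X`, `{x}`, `Y` partition the ground set,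
`x` is spanned by both `X` and `Y`, both of rank at least three, and `λ(X) = λ(Y) = 2`. -/
structure IsVertSep (M : Matroid α) (X : Set α) (x : α) (Y : Set α) : Prop where
  mem_ground : x ∈ M.E
  union_eq : X ∪ Y = M.E \ {x}
  disjoint : Disjoint X Y
  mem_left : x ∈ M.closure X
  mem_right : x ∈ M.closure Y
  three_le_left : 3 ≤ M.rkNat X
  three_le_right : 3 ≤ M.rkNat Y
  add_eq : M.rkNat X + M.rkNat Y = M.rkNat M.E + 2

lemma IsVertSep.symm (h : M.IsVertSep X x Y) : M.IsVertSep Y x X :=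
  ⟨h.mem_ground, by rw [union_comm, h.union_eq], h.disjoint.symm, h.mem_right, h.mem_left,
    h.three_le_right, h.three_le_left, by rw [add_comm, h.add_eq]⟩

lemma IsVertSep.mem_iff (h : M.IsVertSep X x Y) (z : α) :
    z ∈ M.E ↔ z ∈ X ∨ z ∈ Y ∨ z = x := by
  have h1 : z ∈ X ∪ Y ↔ z ∈ M.E \ {x} := by rw [h.union_eq]
  have h2 := h.mem_ground
  simp only [mem_union, mem_sdiff, mem_singleton_iff] at h1
  constructor
  · grind
  · rintro (h | h | rfl) <;> grind

lemma IsVertSep.subset_left (h : M.IsVertSep X x Y) : X ⊆ M.E :=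
  fun z hz ↦ (h.mem_iff z).2 (.inl hz)

lemma IsVertSep.subset_right (h : M.IsVertSep X x Y) : Y ⊆ M.E := h.symm.subset_left

lemma IsVertSep.notMem_left (h : M.IsVertSep X x Y) : x ∉ X := fun hx ↦ by
  have : x ∈ M.E \ {x} := by rw [← h.union_eq]; exact .inl hx
  exact this.2 rfl

lemma IsVertSep.notMem_right (h : M.IsVertSep X x Y) : x ∉ Y := h.symm.notMem_left

lemma IsVertSep.notMem_of_mem (h : M.IsVertSep X x Y) (hz : e ∈ X) : e ∉ Y :=
  disjoint_left.1 h.disjoint hz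

lemma IsVertSep.compl_left (h : M.IsVertSep X x Y) : M.E \ X = insert x Y := by
  ext z
  have h1 := h.mem_iff z
  have h2 := h.notMem_left
  have h3 := h.notMem_of_mem (e := z)
  clear * - h1 h2 h3
  grind

lemma IsVertSep.compl_insert_left (h : M.IsVertSep X x Y) : M.E \ insert x X = Y := by
  ext z
  have h1 := h.mem_iff z
  have h2 := h.notMem_right
  have h3 := h.notMem_of_mem (e := z)
  clear * - h1 h2 h3
  grind

lemma IsVertSep.rkNat_insert_left (h : M.IsVertSep X x Y) :
    M.rkNat (insert x X) = M.rkNat X := rkNat_insert_of_mem_closure h.mem_left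

lemma IsVertSep.rkNat_insert_right (h : M.IsVertSep X x Y) :
    M.rkNat (insert x Y) = M.rkNat Y := rkNat_insert_of_mem_closure h.mem_right

lemma IsVertSep.rkSum_left (h : M.IsVertSep X x Y) : M.rkSum X = M.rkNat M.E + 2 := by
  rw [rkSum, h.compl_left, h.rkNat_insert_right, h.add_eq]

lemma IsVertSep.rkSum_insert_left (h : M.IsVertSep X x Y) :
    M.rkSum (insert x X) = M.rkNat M.E + 2 := by
  rw [rkSum, h.compl_insert_left, h.rkNat_insert_left, h.add_eq]

/-- Since s is spanned by the rest, E \ Z and E \ (Z ∪ s) have equal rank; the inequality opposite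
to `h3` is 3-connectivity. -/
lemma isVertSep_of_rkSum_le [M.Finite] (hM : M.IsNConnected 3) (hZ : Z ⊆ M.E) (hs : s ∈ M.E)
    (hsZ : s ∉ Z) (h1 : s ∈ M.closure Z) (h2 : s ∈ M.closure (M.E \ insert s Z))
    (h3 : M.rkSum Z ≤ M.rkNat M.E + 2) (h4 : 3 ≤ M.rkNat Z)
    (h5 : 3 ≤ M.rkNat (M.E \ insert s Z)) : M.IsVertSep Z s (M.E \ insert s Z) := by
  have hE : M.E \ Z = insert s (M.E \ insert s Z) := by clear * - hs hsZ; grind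
  have hr : M.rkNat (M.E \ Z) = M.rkNat (M.E \ insert s Z) := by
    rw [hE, rkNat_insert_of_mem_closure h2]
  refine ⟨hs, by clear * - hZ hsZ; grind, disjoint_left.2 fun a ha hb ↦ hb.2 (.inr ha), h1, h2,
    h4, h5, ?_⟩
  have := hM.add_two_le hZ (nontrivial_of_two_le_rkNat (M := M) (by omega))
    (nontrivial_of_two_le_rkNat (M := M) (by omega))
  rw [rkSum] at this h3
  omega

/-- The right side of a vertical `3`-separation may be taken to be closed. -/
lemma IsVertSep.exists_closed [M.Finite] (hM : M.IsNConnected 3) (h : M.IsVertSep X x Y) :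
    ∃ X' Y', M.IsVertSep X' x Y' ∧ X' ⊆ X ∧ Y ⊆ Y' ∧ M.closure (insert x Y') = insert x Y' := by
  have hE : M.E.Nontrivial :=
    (nontrivial_of_two_le_rkNat (h.three_le_left.trans' (by norm_num))).mono h.subset_left
  have hxc := h.mem_right
  have hYc := M.subset_closure Y h.subset_right
  have hins : insert x (M.closure Y \ {x}) = M.closure Y := by clear * - hxc; grind
  have hcl : M.rkNat (M.closure Y \ {x}) = M.rkNat Y := by
    have hxY := h.notMem_right
    rw [rkNat_eq_of_subset_closure (X := Y) _ sdiff_subset]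
    exact subset_sdiff.2 ⟨hYc, by simpa⟩
  have hcompl : M.E \ (X \ M.closure Y) = M.closure Y := by
    ext z
    have h1 := h.mem_iff z
    have h2 := M.closure_subset_ground Y (a := z)
    have h3 := @hYc z
    clear * - h1 h2 h3 hxc
    grind
  have hsub : X \ M.closure Y ⊆ M.E := sdiff_subset.trans h.subset_left
  have hr1 : M.rkNat (X \ M.closure Y) ≤ M.rkNat X := M.rkNat_mono sdiff_subset
  have hadd := h.add_eq
  have h3l := h.three_le_left
  have h3r := h.three_le_right
  -- Moving X ∩ cl(Y) to the right costs no rank on the left: otherwise λ would drop below 2.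
  have hge : M.rkNat X ≤ M.rkNat (X \ M.closure Y) := by
    by_cases hnt : (X \ M.closure Y).Nontrivial
    · have := hM.add_two_le hsub hnt (by
        rw [hcompl]; exact nontrivial_of_two_le_rkNat (M := M) (by rw [rkNat_closure]; omega))
      rw [rkSum, hcompl, rkNat_closure] at this
      omega
    exfalso
    rw [not_nontrivial_iff] at hnt
    obtain h0 | ⟨z, hz⟩ := hnt.eq_empty_or_singleton
    · rw [h0, sdiff_empty] at hcompl
      rw [hcompl, rkNat_closure] at hadd
      omega
    · have hzE : z ∈ M.E := hsub (by rw [hz]; rfl)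
      have := hM.rkNat_diff_singleton hE hzE
      rw [← hz, hcompl, rkNat_closure] at this
      omega
  have hX : X ⊆ M.closure (X \ M.closure Y) :=
    subset_closure_of_rkNat_le sdiff_subset h.subset_left hge
  refine ⟨X \ M.closure Y, M.closure Y \ {x}, ?_, sdiff_subset,
    subset_sdiff.2 ⟨hYc, by simpa using h.notMem_right⟩, by rw [hins, closure_closure]⟩
  refine ⟨h.mem_ground, ?_, ?_, ?_, ?_, by omega, by omega, by omega⟩
  · ext z
    have h1 := h.mem_iff z
    have h2 := M.closure_subset_ground Y (a := z)
    have h3 := @hYc z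
    have h4 := h.notMem_left
    clear * - h1 h2 h3 h4
    grind
  · exact disjoint_left.2 fun a ha hb ↦ ha.2 hb.1
  · exact M.closure_subset_closure_of_subset_closure hX h.mem_left
  · rw [mem_closure_iff_rkNat h.mem_ground, hins, rkNat_closure, hcl]

/-- A separation of si(M/x) expands along parallel classes to one of M/x of the same connectivity.
Putting x back gives λ ≤ 2 in M, and x must be spanned by both sides, as otherwise M itself would
have a 2-separation. -/
lemma exists_isVertSep [M.Finite] (hM : M.IsNConnected 3) (hE : 5 ≤ M.E.encard) (hx : x ∈ M.E)
    (h : ¬ (M ／ {x}).si.IsNConnected 3) : ∃ X Y, M.IsVertSep X x Y := by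
  have hE4 : 4 ≤ M.E.encard := le_trans (by norm_num) hE
  have hEnt : M.E.Nontrivial := two_le_encard_iff_nontrivial.1 (le_trans (by norm_num) hE)
  have hx1 := hM.rkNat_singleton hEnt hx
  have hcon := fun (Z : Set α) (hZ : Z ⊆ M.E \ {x}) ↦ rkNat_contractElem_add_one hx1 hZ
  simp only [IsNConnected, not_forall, not_not] at h
  obtain ⟨k, hk, U, hU, hconn, hU1, hU2⟩ := h
  obtain ⟨P, hP, hPU, hPconn, -⟩ := exists_expand_si hU
  rw [← hPconn] at hconn
  change P ⊆ M.E \ {x} at hP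
  set Q := (M.E \ {x}) \ P with hQ
  have hUP : U ⊆ P := by rw [← hPU]; exact inter_subset_left
  have hVQ : (M ／ {x}).si.E \ U ⊆ Q := by
    intro z hz
    refine ⟨(M ／ {x}).si_ground_subset hz.1, fun h ↦ hz.2 ?_⟩
    rw [← hPU]
    exact ⟨h, hz.1⟩
  have hPE : P ⊆ M.E := hP.trans sdiff_subset
  have hQE : Q ⊆ M.E := sdiff_subset.trans sdiff_subset
  have hxP : x ∉ P := fun h ↦ (hP h).2 rfl
  have hxQ : x ∉ Q := fun h ↦ h.1.2 rfl
  have hPc : M.E \ P = insert x Q := by clear * - hQ hx hxP; grind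
  have hQc : M.E \ Q = insert x P := by clear * - hQ hx hxP hP; grind
  have hsum : M.rkNat (insert x P) + M.rkNat (insert x Q) < M.rkNat M.E + 1 + k := by
    have h1 := hcon P hP
    have h2 := hcon Q sdiff_subset
    have h3 := hcon _ Subset.rfl
    rw [show insert x (M.E \ {x}) = M.E by clear * - hx; grind] at h3
    rw [connFun, contract_ground, ← hQ] at hconn
    omega
  have hle : M.rkNat P ≤ M.rkNat (insert x P) ∧ M.rkNat Q ≤ M.rkNat (insert x Q) :=
    ⟨M.rkNat_mono (subset_insert _ _), M.rkNat_mono (subset_insert _ _)⟩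
  -- Two distinct elements of the simplification have rank 2 in M/x, hence rank 3 together with x in
  -- M.
  have key : k = 2 → ∀ S ⊆ (M ／ {x}).si.E, (2 : ℕ∞) ≤ S.encard → ∀ T, S ⊆ T → T ⊆ M.E \ {x} →
      3 ≤ M.rkNat (insert x T) := by
    intro _ S hS hScard T hST hT
    obtain ⟨a, ha, b, hb, hab⟩ := two_le_encard_iff_nontrivial.1 hScard
    by_contra! hlt
    have h1 := hcon T hT
    have h2 : (M ／ {x}).rkNat {a, b} ≤ (M ／ {x}).rkNat T :=
      (M ／ {x}).rkNat_mono (pair_subset (hST ha) (hST hb))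
    have hna := isNonloop_of_mem_si (hS ha)
    have hnb := isNonloop_of_mem_si (hS hb)
    have h3 : (M ／ {x}).rkNat {b} = 1 := by
      rw [rkNat, hnb.eRk_eq]; rfl
    have h4 : a ∈ (M ／ {x}).closure {b} := by
      rw [mem_closure_iff_rkNat hna.mem_ground]
      omega
    have h5 := parallelRep_congr hna (hna.closure_eq_of_mem_closure h4)
    rw [parallelRep_of_mem_si (hS ha), parallelRep_of_mem_si (hS hb)] at h5
    exact hab h5
  have hnt : ∀ S T, S ⊆ M.E → S.Nontrivial → T.Nonempty → M.E \ S = insert x T → x ∉ T →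
      M.rkNat M.E + 2 ≤ M.rkNat S + M.rkNat (insert x T) := by
    intro S T hS hnt ⟨t, ht⟩ hST hxT
    have := hM.add_two_le hS hnt (by
      rw [hST]
      exact ⟨x, mem_insert _ _, t, mem_insert_of_mem _ ht, by rintro rfl; exact hxT ht⟩)
    rwa [rkSum, hST] at this
  -- k = 0 would make λ negative. For k = 1, as |E| ≥ 4, one side has two elements, and it would be
  -- a side of a 2-separation of M. Only k = 2 survives.
  obtain rfl | rfl | rfl : k = 0 ∨ k = 1 ∨ k = 2 := by omega
  · have h1 := M.rkNat_submod (insert x P) (insert x Q)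
    have h2 : M.rkNat {x} ≤ M.rkNat (insert x P ∩ insert x Q) :=
      M.rkNat_mono (by clear * -; grind)
    rw [show insert x P ∪ insert x Q = M.E by clear * - hx hP hQ; grind] at h1
    omega
  · have hP0 : P.Nonempty := (one_le_encard_iff_nonempty.1 hU1).mono hUP
    have hQ0 : Q.Nonempty := (one_le_encard_iff_nonempty.1 hU2).mono hVQ
    exfalso
    by_cases hPnt : P.Nontrivial
    · have := hnt P Q hPE hPnt hQ0 hPc hxQ
      omega
    by_cases hQnt : Q.Nontrivial
    · have := hnt Q P hQE hQnt hP0 hQc hxP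
      omega
    rw [not_nontrivial_iff] at hPnt hQnt
    obtain ⟨p, rfl⟩ := (hPnt.eq_empty_or_singleton).resolve_left hP0.ne_empty
    obtain ⟨q, hq⟩ := (hQnt.eq_empty_or_singleton).resolve_left hQ0.ne_empty
    have h1 := nontrivial_diff_pair hE4 p q
    obtain ⟨z, hz, hzx⟩ := h1.exists_ne x
    have : z ∈ Q := ⟨⟨hz.1, hzx⟩, fun h ↦ hz.2 (.inl h)⟩
    rw [hq] at this
    exact hz.2 (.inr this)
  · have hPnt : P.Nontrivial := (two_le_encard_iff_nontrivial.1 hU1).mono hUP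
    have hQnt : Q.Nontrivial := (two_le_encard_iff_nontrivial.1 hU2).mono hVQ
    have h1 := hnt P Q hPE hPnt hQnt.nonempty hPc hxQ
    have h2 := hnt Q P hQE hQnt hPnt.nonempty hQc hxP
    have h3 := key rfl U hU hU1 P hUP hP
    have h4 := key rfl _ sdiff_subset hU2 Q hVQ sdiff_subset
    refine ⟨P, Q, hx, by clear * - hP hQ; grind, disjoint_left.2 fun a ha hb ↦ hb.2 ha, ?_, ?_,
      by omega, by omega, by omega⟩
    · rw [mem_closure_iff_rkNat hx]; omega
    · rw [mem_closure_iff_rkNat hx]; omega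

/-- Contracting x lowers r(X), r(Y) and r(M) by one each, so (X, Y) is an exact 2-separation of M/x
and `IsMinor.exists_isIsomorphic_contract` applies; a minor of M/x/s is in particular a minor of
M/s. -/
lemma IsVertSep.exists_isIsomorphic_contract [M.Finite] (hM : M.IsNConnected 3)
    (h : M.IsVertSep X x Y) (hNM : N ≤m M ／ {x}) (hN : N.IsNConnected 3)
    (hcard : 4 ≤ N.E.encard) (hX : (X ∩ N.E).Subsingleton) (hs : s ∈ X)
    (hsY : s ∉ M.closure (insert x Y)) :
    ∃ N', N' ≤m M ／ {s} ∧ N.IsIsomorphic N' ∧ (X ∩ N'.E).Subsingleton := by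
  have hx1 := hM.rkNat_singleton ((nontrivial_of_two_le_rkNat
    (h.three_le_left.trans' (by norm_num))).mono h.subset_left) h.mem_ground
  have hXE : X ⊆ M.E \ {x} := subset_sdiff.2 ⟨h.subset_left, by simpa using h.notMem_left⟩
  have hYE : Y ⊆ M.E \ {x} := subset_sdiff.2 ⟨h.subset_right, by simpa using h.notMem_right⟩
  have h1 := rkNat_contractElem_add_one hx1 hXE
  have h2 := rkNat_contractElem_add_one hx1 hYE
  have h3 := rkNat_contractElem_add_one hx1 Subset.rfl
  have hx := h.mem_ground
  rw [show insert x (M.E \ {x}) = M.E by clear * - hx; grind] at h3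
  rw [h.rkNat_insert_left] at h1
  rw [h.rkNat_insert_right] at h2
  have h4 := h.add_eq
  obtain ⟨N', hN', hiso, hsub⟩ := hNM.exists_isIsomorphic_contract hN hcard (X := X) (Y := Y)
    (by rw [h.union_eq]; rfl) h.disjoint (by rw [contract_ground]; omega) hX hs (by
      rw [contract_closure_eq, union_singleton]
      exact fun hs' ↦ hsY hs'.1)
  refine ⟨N', ?_, hiso, hsub⟩
  rw [contract_comm] at hN'
  obtain ⟨C, D, rfl⟩ := hN'
  rw [contract_contract]
  exact contract_delete_isMinor ..

/-- λ(X) = 1 in M/x, and λ does not grow in minors; two elements of N on each side would therefore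
give a 2-separation of N. -/
lemma IsVertSep.subsingleton_or_subsingleton [M.Finite] (hM : M.IsNConnected 3)
    (h : M.IsVertSep X x Y) (hNM : N ≤m M ／ {x}) (hN : N.IsNConnected 3) :
    (X ∩ N.E).Subsingleton ∨ (Y ∩ N.E).Subsingleton := by
  have hx1 := hM.rkNat_singleton ((nontrivial_of_two_le_rkNat
    (h.three_le_left.trans' (by norm_num))).mono h.subset_left) h.mem_ground
  have hXE : X ⊆ M.E \ {x} := subset_sdiff.2 ⟨h.subset_left, by simpa using h.notMem_left⟩
  have hYE : Y ⊆ M.E \ {x} := subset_sdiff.2 ⟨h.subset_right, by simpa using h.notMem_right⟩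
  have h1 := rkNat_contractElem_add_one hx1 hXE
  have h2 := rkNat_contractElem_add_one hx1 hYE
  have h3 := rkNat_contractElem_add_one hx1 Subset.rfl
  have hx := h.mem_ground
  rw [show insert x (M.E \ {x}) = M.E by clear * - hx; grind] at h3
  rw [h.rkNat_insert_left] at h1
  rw [h.rkNat_insert_right] at h2
  have h4 := h.add_eq
  have hle := hNM.connFun_inter_le X
  have hNE : N.E ⊆ M.E \ {x} := hNM.subset
  have hY : (M.E \ {x}) \ X = Y := by
    rw [← h.union_eq, union_sdiff_cancel_left h.disjoint.le_bot]
  rw [connFun, connFun, contract_ground, hY] at hle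
  by_contra! hcon
  have h5 := hN.add_two_le (X := X ∩ N.E) inter_subset_right hcon.1
    (hcon.2.mono fun z hz ↦ ⟨hz.2, fun h' ↦ h.notMem_of_mem h'.1 hz.1⟩)
  rw [rkSum] at h5
  omega

end VertSep

end Matroid

namespace Matroid

variable {α : Type*} {M N : Matroid α} {X Y Z C D W L : Set α} {e f x s : α}

/-! ### 3-connectivity of co(si(M/l)) for an element l of a special line. -/

section Cosimple

lemma subset_closure_si_diff (M : Matroid α) (hZ : Z ⊆ M.E) (h : ∀ z ∈ Z, M.parallelRep z ≠ e) :
    Z ⊆ M.closure (M.si.E \ {e}) := by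
  intro z hz
  by_cases hl : M.IsNonloop z
  · have := M.mem_closure_self z (hZ hz)
    rw [← closure_parallelRep] at this
    have h' : M.parallelRep z ∈ M.si.E \ {e} := ⟨parallelRep_mem_si hl, h z hz⟩
    exact M.closure_subset_closure (singleton_subset_iff.2 h') this
  rw [not_isNonloop_iff] at hl
  exact hl.mem_closure _

lemma isCocircuit_of_closure_compl [M.Finite] {K : Set α} (hK : K ⊆ M.E)
    (hcl : M.closure (M.E \ K) = M.E \ K) (hr : M.rkNat (M.E \ K) + 1 = M.rkNat M.E) :
    M.IsCocircuit K := by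
  rw [isCocircuit_iff_minimal_compl_nonspanning]
  refine ⟨fun h ↦ ?_, fun K' hK' hle z hz ↦ by_contra fun hzK' ↦ hK' ?_⟩
  · have := h.eRk_eq
    rw [← eRk_ground, ← coe_rkNat, ← coe_rkNat] at this
    have : M.rkNat (M.E \ K) = M.rkNat M.E := by exact_mod_cast this
    omega
  · have h1 : M.rkNat (insert z (M.E \ K)) = M.rkNat (M.E \ K) + 1 := by
      refine rkNat_insert_of_notMem_closure (hK hz) ?_
      rw [hcl]
      exact fun h ↦ h.2 hz
    have h2 := M.rkNat_mono (show insert z (M.E \ K) ⊆ M.E \ K' from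
      insert_subset ⟨hK hz, hzK'⟩ (sdiff_subset_sdiff_right hle))
    rw [spanning_iff_eRk_le, ← eRk_ground, ← coe_rkNat, ← coe_rkNat]
    exact_mod_cast (by omega)

lemma IsNConnected.isTriangle [M.Finite] (hM : M.IsNConnected 3) (hE : 4 ≤ M.E.encard)
    {a b c : α} (hab : a ≠ b) (hac : a ≠ c) (hbc : b ≠ c) (hs : {a, b, c} ⊆ M.E)
    (hr : M.rkNat {a, b, c} ≤ 2) : M.IsTriangle {a, b, c} := by
  have hcard : ({a, b, c} : Set α).ncard = 3 := ncard_eq_three.2 ⟨a, b, c, hab, hac, hbc, rfl⟩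
  have hfin : ({a, b, c} : Set α).Finite := by simp
  have hind : ∀ p q, p ∈ M.E → q ∈ M.E → p ≠ q → M.Indep {p, q} := fun p q hp hq hpq ↦ by
    rw [indep_iff_rkNat (by simp), hM.rkNat_pair hE hp hq hpq, ncard_pair hpq]
  have ha : a ∈ M.E := hs (by simp)
  have hb : b ∈ M.E := hs (by simp)
  have hc : c ∈ M.E := hs (by simp)
  refine ⟨?_, by rw [← hfin.cast_ncard_eq, hcard]; rfl⟩
  rw [isCircuit_iff_dep_forall_sdiff_singleton_indep, Dep, indep_iff_rkNat hfin]
  refine ⟨⟨by omega, hs⟩, ?_⟩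
  rintro z (rfl | rfl | rfl)
  · rw [show ({z, b, c} : Set α) \ {z} = {b, c} by clear * - hab hac; grind]
    exact hind _ _ hb hc hbc
  · rw [show ({a, z, c} : Set α) \ {z} = {a, c} by clear * - hab hbc; grind]
    exact hind _ _ ha hc hac
  · rw [show ({a, b, z} : Set α) \ {z} = {a, b} by clear * - hac hbc; grind]
    exact hind _ _ ha hb hab

lemma rkNat_add_lt_of_connFun_contract [M.Finite] (hx : x ∈ M.E) (hx1 : M.rkNat {x} = 1)
    (hX : X ⊆ M.E \ {x}) {k : ℕ} (h : (M ／ {x}).connFun X < k) :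
    M.rkNat (insert x X) + M.rkNat (insert x ((M.E \ {x}) \ X)) < M.rkNat M.E + 1 + k := by
  have h1 := rkNat_contractElem_add_one hx1 hX
  have h2 := rkNat_contractElem_add_one hx1 (sdiff_subset : (M.E \ {x}) \ X ⊆ M.E \ {x})
  have h3 := rkNat_contractElem_add_one hx1 Subset.rfl
  rw [show insert x (M.E \ {x}) = M.E by clear * - hx; grind] at h3
  rw [connFun, contract_ground] at h
  omega

lemma IsNConnected.not_rkSum_lt [M.Finite] (hM : M.IsNConnected 3) {k : ℕ} (hk : k < 3)
    (hX : X ⊆ M.E) (h1 : k ≤ X.encard) (h2 : k ≤ (M.E \ X).encard)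
    (h : M.rkSum X < M.rkNat M.E + k) : False := by
  have := hM.le_connFun hk hX h1 h2
  rw [connFun_eq] at this
  omega

/-- The complement of (L \ l) ∪ d contains l. If it also spanned z it would span all of L, hence E \
d, which is spanning by 3-connectivity. -/
lemma IsNConnected.notMem_closure_compl_insert [M.Finite] (hM : M.IsNConnected 3)
    (hE : 4 ≤ M.E.encard) (hLr : M.rkNat L ≤ 2) (hLE : L ⊆ M.E) {l d z : α} (hl : l ∈ L)
    (hd : d ∈ M.E \ L) (hK : M.rkNat (M.E \ insert d (L \ {l})) < M.rkNat M.E) (hz : z ∈ L)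
    (hzl : z ≠ l) : z ∉ M.closure (M.E \ insert d (L \ {l})) := by
  have hEnt : M.E.Nontrivial := two_le_encard_iff_nontrivial.1 (le_trans (by norm_num) hE)
  intro hzc
  set K := insert d (L \ {l})
  have hlK : l ∈ M.closure (M.E \ K) := M.mem_closure_of_mem'
    ⟨hLE hl, by rintro (rfl | h); exacts [hd.2 hl, h.2 rfl]⟩ (hLE hl)
  have hLc : L ⊆ M.closure (M.E \ K) := (subset_closure_of_rkNat_le (pair_subset hz hl) hLE
      (by rw [hM.rkNat_pair hE (hLE hz) (hLE hl) hzl]; exact hLr)).trans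
    (M.closure_subset_closure_of_subset_closure (pair_subset hzc hlK))
  have hsub : M.E \ {d} ⊆ M.closure (M.E \ K) := by
    intro w hw
    by_cases hwL : w ∈ L
    · exact hLc hwL
    refine M.mem_closure_of_mem' ⟨hw.1, ?_⟩ hw.1
    rintro (rfl | h)
    exacts [hw.2 rfl, hwL h.1]
  have h1 := M.rkNat_mono hsub
  rw [rkNat_closure, hM.rkNat_diff_singleton hEnt hd.1] at h1
  omega

/-- If `L` is a line and three of its elements `l` have the property that `(L \ {l}) ∪ {d}` is
a cocircuit for some `d`, then `co(si(M / l))` is `3`-connected for such an `l`. -/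
lemma isNConnected_co_si_contract [M.Finite] (hM : M.IsNConnected 3) (hE : 4 ≤ M.E.encard)
    (hLr : M.rkNat L = 2) (hLcl : M.closure L = L)
    {l₁ l₂ l₃ d₁ d₂ d₃ : α} (h₁ : l₁ ∈ L) (h₂ : l₂ ∈ L) (h₃ : l₃ ∈ L) (h₁₂ : l₁ ≠ l₂)
    (h₁₃ : l₁ ≠ l₃) (h₂₃ : l₂ ≠ l₃) (hd₁ : d₁ ∈ M.E \ L) (hd₂ : d₂ ∈ M.E \ L)
    (hd₃ : d₃ ∈ M.E \ L)
    (hK₁ : M.rkNat (M.E \ insert d₁ (L \ {l₁})) < M.rkNat M.E)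
    (hK₂ : M.rkNat (M.E \ insert d₂ (L \ {l₂})) < M.rkNat M.E)
    (hK₃ : M.rkNat (M.E \ insert d₃ (L \ {l₃})) < M.rkNat M.E) :
    (M ／ {l₁}).si.co.IsNConnected 3 := by
  have hLE : L ⊆ M.E := by rw [← hLcl]; exact M.closure_subset_ground L
  have hEnt : M.E.Nontrivial := two_le_encard_iff_nontrivial.1 (le_trans (by norm_num) hE)
  have hpair : ∀ p ∈ L, ∀ q ∈ L, p ≠ q → L ⊆ M.closure {p, q} := fun p hp q hq hpq ↦
    subset_closure_of_rkNat_le (pair_subset hp hq) hLE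
      (by rw [hLr, hM.rkNat_pair hE (hLE hp) (hLE hq) hpq])
  have hline := fun l d hl hd hK z hz hzl ↦
    hM.notMem_closure_compl_insert hE hLr.le hLE (l := l) (d := d) (z := z) hl hd hK hz hzl
  have hx : l₁ ∈ M.E := hLE h₁
  have hx1 := hM.rkNat_singleton hEnt hx
  have ha₂ := hline l₂ d₂ h₂ hd₂ hK₂
  have ha₃ := hline l₃ d₃ h₃ hd₃ hK₃
  have hcon := fun (Z : Set α) (hZ : Z ⊆ M.E \ {l₁}) ↦ rkNat_contractElem_add_one hx1 hZ
  -- the final contradiction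
  have fin : ∀ (k : ℕ) (S T V : Set α) (m : α), k < 3 → S ∪ T = M.E \ {l₁} → Disjoint S T →
      L \ {l₁} ⊆ S → d₁ ∈ S → V ⊆ S → k ≤ V.encard → k ≤ T.encard → V ∩ L ⊆ {m} →
      ¬ (m ∈ V ∧ d₁ ∈ V) →
      M.rkNat (insert l₁ S) + M.rkNat (insert l₁ T) < M.rkNat M.E + 1 + k → False := by
    intro k S T V m hk hU hdj hLS hdS hVS hVk hTk hVL hmV hsum
    have hdj' := disjoint_left.1 hdj
    have hSE : S ⊆ M.E := fun z hz ↦ (hU.subset (.inl hz)).1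
    have hTE : T ⊆ M.E := fun z hz ↦ (hU.subset (.inr hz)).1
    have hxS : l₁ ∉ S := fun h ↦ (hU.subset (.inl h)).2 rfl
    have hxT : l₁ ∉ T := fun h ↦ (hU.subset (.inr h)).2 rfl
    have hmem : ∀ z ∈ M.E, z ≠ l₁ → z ∈ S ∨ z ∈ T := fun z hz hne ↦ hU.superset ⟨hz, hne⟩
    have hfin1 : ∀ l d, l ∈ L → d ∈ S → l₁ ≠ l → l₁ ∉ M.closure (M.E \ insert d (L \ {l})) →
        False := by
      intro l d hl hd hne hnot
      have h1 : T ⊆ M.E \ insert d (L \ {l}) := by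
        refine fun z hz ↦ ⟨hTE hz, ?_⟩
        rintro (rfl | h)
        · exact hdj' hd hz
        · exact hdj' (hLS ⟨h.1, by rintro rfl; exact hxT hz⟩) hz
      have h2 := rkNat_insert_of_notMem_closure hx
        (fun h ↦ hnot (M.closure_subset_closure h1 h))
      have h3 : M.E \ insert l₁ S = T := by clear * - hmem hTE hxT hdj'; grind
      refine hM.not_rkSum_lt hk (insert_subset hx hSE)
        (hVk.trans (encard_le_encard (hVS.trans (subset_insert _ _)))) (by rwa [h3]) ?_
      rw [rkSum, h3]
      omega
    -- If d₂ ∈ S, then T misses (L \ l₂) ∪ d₂, so T does not span l₁ and (S ∪ l₁, T) is a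
    -- k-separation of M. The same works for d₃.
    by_cases hS2 : d₂ ∈ S
    · exact hfin1 l₂ d₂ h₂ hS2 h₁₂ (ha₂ l₁ h₁ h₁₂)
    by_cases hS3 : d₃ ∈ S
    · exact hfin1 l₃ d₃ h₃ hS3 h₁₃ (ha₃ l₁ h₁ h₁₃)
    -- Otherwise S \ L misses both (L \ l₂) ∪ d₂ and (L \ l₃) ∪ d₃, so adding l₃ and then l₂ raises
    -- its rank twice, whereas T ∪ L has rank at most one more than T ∪ l₁. The net gain of one
    -- makes (S \ L, T ∪ L) a k-separation of M.
    have hc : M.E \ (S \ L) = T ∪ L := by clear * - hmem hTE hdj' h₁ hLE; grind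
    have hs1 : S \ L ⊆ M.E \ insert d₂ (L \ {l₂}) := fun z hz ↦ ⟨hSE hz.1, by
      rintro (rfl | h)
      exacts [hS2 hz.1, hz.2 h.1]⟩
    have hs2 : insert l₃ (S \ L) ⊆ M.E \ insert d₃ (L \ {l₃}) :=
      insert_subset ⟨hLE h₃, by
        rintro (rfl | h)
        exacts [hd₃.2 h₃, h.2 rfl]⟩ (fun z hz ↦ ⟨hSE hz.1, by
        rintro (rfl | h)
        exacts [hS3 hz.1, hz.2 h.1]⟩)
    have r1 := rkNat_insert_of_notMem_closure (X := S \ L) (hLE h₃) fun h ↦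
      ha₂ l₃ h₃ h₂₃.symm (M.closure_subset_closure hs1 h)
    have r2 := rkNat_insert_of_notMem_closure (X := insert l₃ (S \ L)) (hLE h₂) fun h ↦
      ha₃ l₂ h₂ h₂₃ (M.closure_subset_closure hs2 h)
    have r3 : M.rkNat (insert l₂ (insert l₃ (S \ L))) ≤ M.rkNat (insert l₁ S) :=
      M.rkNat_mono (insert_subset (.inr (hLS ⟨h₂, h₁₂.symm⟩))
        (insert_subset (.inr (hLS ⟨h₃, h₁₃.symm⟩)) (sdiff_subset.trans (subset_insert _ _))))
    have r4 : M.rkNat (T ∪ L) ≤ M.rkNat (insert l₁ T) + 1 := by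
      refine le_trans ?_ (M.rkNat_insert_le l₂ (insert l₁ T))
      rw [← M.rkNat_closure (insert l₂ _)]
      refine M.rkNat_mono (union_subset ?_ ?_)
      · exact M.subset_closure_of_subset (fun z hz ↦ .inr (.inr hz))
          (insert_subset (hLE h₂) (insert_subset hx hTE))
      · exact (hpair l₁ h₁ l₂ h₂ h₁₂).trans (M.closure_subset_closure (by clear * -; grind))
    refine hM.not_rkSum_lt hk (sdiff_subset.trans hSE) (X := S \ L) ?_ ?_ ?_
    -- Removing L from V loses at most m, and then d₁ ∈ S \ L, which is not in V, takes its place.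
    · by_cases hm : m ∈ V
      · have hdV : d₁ ∉ V := fun h ↦ hmV ⟨hm, h⟩
        rw [← encard_exchange hdV hm] at hVk
        refine hVk.trans (encard_le_encard (insert_subset ⟨hdS, hd₁.2⟩ fun z hz ↦ ⟨hVS hz.1, ?_⟩))
        exact fun h ↦ hz.2 (hVL ⟨hz.1, h⟩)
      · refine hVk.trans (encard_le_encard fun z hz ↦ ⟨hVS hz, fun h ↦ ?_⟩)
        have := hVL ⟨hz, h⟩
        rw [mem_singleton_iff] at this
        exact hm (this ▸ hz)
    · rw [hc]
      exact hTk.trans (encard_le_encard subset_union_left)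
    · rw [rkSum, hc]
      omega
  -- parallel classes of the contraction
  set K := (M ／ {l₁}).si with hKdef
  have hKE : K.E ⊆ M.E \ {l₁} := si_ground_subset _
  have hnl : ∀ z ∈ M.E \ {l₁}, (M ／ {l₁}).IsNonloop z := by
    intro z hz
    rw [contract_isNonloop_iff]
    refine ⟨hz.1, ?_⟩
    rw [mem_closure_iff_rkNat hz.1, hM.rkNat_pair hE hz.1 hx hz.2]
    omega
  have hclL : ∀ z ∈ L \ {l₁}, (M ／ {l₁}).closure {z} = L \ {l₁} := by
    intro z hz
    rw [contract_closure_eq, singleton_union]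
    congr 1
    refine subset_antisymm ?_ (hpair z hz.1 l₁ h₁ hz.2)
    conv_rhs => rw [← hLcl]
    exact M.closure_subset_closure (pair_subset hz.1 h₁)
  -- d₁ is parallel to nothing in M/l₁. A parallel f outside L would put d₁ in the closure of the
  -- complement of (L \ l₁) ∪ d₁, so E \ (L \ l₁) would be nonspanning, and L \ l₁, of rank at most
  -- 2, would have λ ≤ 1.
  have hcld : (M ／ {l₁}).closure {d₁} = {d₁} := by
    have hd₁' : d₁ ∈ M.closure {d₁, l₁} := M.mem_closure_of_mem' (by simp) hd₁.1
    have hne : d₁ ≠ l₁ := by rintro rfl; exact hd₁.2 h₁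
    rw [contract_closure_eq, singleton_union]
    refine subset_antisymm (fun f hf ↦ by_contra fun hfd ↦ ?_) (by simpa using ⟨hd₁', hne⟩)
    rw [mem_singleton_iff] at hfd
    have hfE : f ∈ M.E := M.closure_subset_ground _ hf.1
    have hdc : d₁ ∈ M.closure {f, l₁} := by
      refine subset_closure_of_rkNat_le (Y := {f, l₁, d₁}) (by clear * -; grind)
        (by clear * - hfE hd₁ hx; grind) ?_ (by simp)
      rw [hM.rkNat_pair hE hfE hx hf.2, show ({f, l₁, d₁} : Set α) = insert f {d₁, l₁} by
        clear * -; grind, rkNat_insert_of_mem_closure hf.1]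
      exact M.rkNat_pair_le _ _
    by_cases hfL : f ∈ L
    · have := M.closure_subset_closure (pair_subset hfL h₁) hdc
      rw [hLcl] at this
      exact hd₁.2 this
    have hsub : M.E \ (L \ {l₁}) ⊆ M.closure (M.E \ insert d₁ (L \ {l₁})) := by
      intro w hw
      by_cases hwd : w = d₁
      · rw [hwd]
        have hs3 : ({f, l₁} : Set α) ⊆ M.E \ insert d₁ (L \ {l₁}) := by
          refine pair_subset ⟨hfE, ?_⟩ ⟨hx, ?_⟩
          · rintro (h | h)
            exacts [hfd h, hfL h.1]
          · rintro (h | h)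
            exacts [hne h.symm, h.2 rfl]
        exact M.closure_subset_closure hs3 hdc
      refine M.mem_closure_of_mem' ⟨hw.1, ?_⟩ hw.1
      rintro (h | h)
      exacts [hwd h, hw.2 h]
    have hr := M.rkNat_mono hsub
    rw [rkNat_closure] at hr
    have h5 := hM.add_two_le (X := L \ {l₁}) (sdiff_subset.trans hLE)
      ⟨l₂, ⟨h₂, h₁₂.symm⟩, l₃, ⟨h₃, h₁₃.symm⟩, h₂₃⟩
      ⟨l₁, ⟨hx, fun h ↦ h.2 rfl⟩, d₁, ⟨hd₁.1, fun h ↦ hd₁.2 h.1⟩, hne.symm⟩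
    have h6 := M.rkNat_mono (sdiff_subset : L \ {l₁} ⊆ L)
    rw [rkSum] at h5
    omega
  have hd₁' : d₁ ∈ M.E \ {l₁} := ⟨hd₁.1, by rintro rfl; exact hd₁.2 h₁⟩
  have hl₂' : l₂ ∈ L \ {l₁} := ⟨h₂, h₁₂.symm⟩
  have hLnl : ∀ z ∈ L \ {l₁}, (M ／ {l₁}).IsNonloop z := fun z hz ↦ hnl z ⟨hLE hz.1, hz.2⟩
  obtain ⟨m, hmK, hmL, hmrep⟩ : ∃ m ∈ K.E, m ∈ L \ {l₁} ∧
      ∀ z ∈ L \ {l₁}, (M ／ {l₁}).parallelRep z = m := by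
    refine ⟨(M ／ {l₁}).parallelRep l₂, parallelRep_mem_si (hLnl l₂ hl₂'), ?_, fun z hz ↦ ?_⟩
    · have := (parallelRep_mem (hLnl l₂ hl₂')).1
      rwa [hclL l₂ hl₂'] at this
    · exact parallelRep_congr (hLnl z hz) (by rw [hclL z hz, hclL l₂ hl₂'])
  have hKL : ∀ z ∈ K.E, z ∈ L → z = m := fun z hz hzL ↦ by
    rw [← hmrep z ⟨hzL, (hKE hz).2⟩, parallelRep_of_mem_si hz]
  have hdK : d₁ ∈ K.E := by
    have h1 := (parallelRep_mem (hnl d₁ hd₁')).1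
    rw [hcld, mem_singleton_iff] at h1
    rw [← h1]
    exact parallelRep_mem_si (hnl d₁ hd₁')
  have hmd : m ≠ d₁ := by rintro rfl; exact hd₁.2 hmL.1
  have hKrk : ∀ Z ⊆ K.E, K.rkNat Z + 1 = M.rkNat (insert l₁ Z) := fun Z hZ ↦ by
    rw [hKdef, rkNat_si hZ, hcon Z (hZ.trans hKE)]
  have hfull : M.rkNat M.E ≤ M.rkNat (insert l₁ K.E) → K.rkNat K.E + 1 = M.rkNat M.E := by
    intro h
    rw [hKrk _ Subset.rfl]
    exact le_antisymm (M.rkNat_le_ground _) h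
  -- Deleting m or d₁ alone does not lower the rank of K, but deleting both does; dually, m and d₁
  -- are parallel nonloops of `K✶`, a series pair of K.
  have hKm : M.rkNat M.E ≤ M.rkNat (insert l₁ (K.E \ {m})) := by
    have h1 : M.E \ L ⊆ (M ／ {l₁}).closure (K.E \ {m}) := by
      refine subset_closure_si_diff _ (fun z hz ↦ ⟨hz.1, fun h ↦ hz.2 (h ▸ h₁)⟩) fun z hz h ↦ hz.2 ?_
      have h2 : z ∈ (M ／ {l₁}).closure {z} :=
        (M ／ {l₁}).mem_closure_self z ⟨hz.1, fun h ↦ hz.2 (h ▸ h₁)⟩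
      rw [← closure_parallelRep, h, hclL m hmL] at h2
      exact h2.1
    rw [contract_closure_eq, union_singleton] at h1
    have h2 : M.E \ (L \ {l₁}) ⊆ M.closure (insert l₁ (K.E \ {m})) := by
      intro z hz
      by_cases hzL : z ∈ L
      · have : z = l₁ := by_contra fun h ↦ hz.2 ⟨hzL, h⟩
        exact M.mem_closure_of_mem' (this ▸ mem_insert _ _) hz.1
      exact (h1 ⟨hz.1, hzL⟩).1
    have h3 := M.rkNat_mono h2
    rw [rkNat_closure] at h3
    have h5 := hM.add_two_le (X := L \ {l₁}) (sdiff_subset.trans hLE)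
      ⟨l₂, ⟨h₂, h₁₂.symm⟩, l₃, ⟨h₃, h₁₃.symm⟩, h₂₃⟩
      ⟨l₁, ⟨hx, fun h ↦ h.2 rfl⟩, d₁, ⟨hd₁.1, fun h ↦ hd₁.2 h.1⟩, hd₁'.2 ∘ Eq.symm⟩
    have h6 := M.rkNat_mono (sdiff_subset : L \ {l₁} ⊆ L)
    rw [rkSum] at h5
    omega
  have hKd : M.rkNat M.E ≤ M.rkNat (insert l₁ (K.E \ {d₁})) := by
    have h1 : (M.E \ {l₁}) \ {d₁} ⊆ (M ／ {l₁}).closure (K.E \ {d₁}) := by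
      refine subset_closure_si_diff _ sdiff_subset fun z hz h ↦ hz.2 ?_
      have h2 : z ∈ (M ／ {l₁}).closure {z} := (M ／ {l₁}).mem_closure_self z hz.1
      rwa [← closure_parallelRep, h, hcld] at h2
    rw [contract_closure_eq, union_singleton] at h1
    have h2 : M.E \ {d₁} ⊆ M.closure (insert l₁ (K.E \ {d₁})) := by
      intro z hz
      by_cases hzl : z = l₁
      · exact M.mem_closure_of_mem' (hzl ▸ mem_insert _ _) hz.1
      exact (h1 ⟨⟨hz.1, hzl⟩, hz.2⟩).1
    have h3 := M.rkNat_mono h2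
    rwa [rkNat_closure, hM.rkNat_diff_singleton hEnt hd₁.1] at h3
  have hKE1 := hfull (hKm.trans (M.rkNat_mono (insert_subset_insert sdiff_subset)))
  have hKmd : K.rkNat (K.E \ {m, d₁}) + 2 ≤ M.rkNat M.E := by
    have h1 := hKrk (K.E \ {m, d₁}) sdiff_subset
    have h2 : insert l₁ (K.E \ {m, d₁}) ⊆ M.E \ insert d₁ (L \ {l₁}) := by
      refine insert_subset ⟨hx, ?_⟩ fun z hz ↦ ⟨(hKE hz.1).1, ?_⟩
      · rintro (h | h)
        exacts [hd₁'.2 h.symm, h.2 rfl]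
      · rintro (h | h)
        exacts [hz.2 (.inr h), hz.2 (.inl (hKL z hz.1 h.1))]
    have h3 := M.rkNat_mono h2
    omega
  have hdm := K.rkNat_dual_add (X := {m}) (by simpa)
  have hdd := K.rkNat_dual_add (X := {d₁}) (by simpa)
  have hdmd := K.rkNat_dual_add (X := {m, d₁}) (pair_subset hmK hdK)
  rw [ncard_singleton] at hdm hdd
  rw [ncard_pair hmd] at hdmd
  have hrm := hKrk (K.E \ {m}) sdiff_subset
  have hrd := hKrk (K.E \ {d₁}) sdiff_subset
  have hle1 := K.rkNat_le_ground (K.E \ {m})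
  have hle2 := K.rkNat_le_ground (K.E \ {d₁})
  have hnonloop : ∀ z, K✶.rkNat {z} = 1 → K✶.IsNonloop z := by
    intro z hz
    rw [← eRk_singleton_eq_one_iff, ← coe_rkNat, hz]
    rfl
  have hmn := hnonloop m (by omega)
  have hdn := hnonloop d₁ (by omega)
  have hser : K✶.closure {m} = K✶.closure {d₁} := by
    refine hmn.closure_eq_of_mem_closure ?_
    rw [mem_closure_iff_rkNat (M := K✶) hmK]
    omega
  -- pull back a separation
  rintro k hk U ⟨hU, hconn, hU1, hU2⟩
  obtain ⟨P, hP, hPU, hPconn, hPser⟩ := exists_expand_co hU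
  obtain ⟨P₂, hP₂, hP₂U, hP₂conn, hP₂par⟩ := exists_expand_si (M := M ／ {l₁}) hP
  rw [← hPconn, ← hP₂conn] at hconn
  have hsum := rkNat_add_lt_of_connFun_contract hx hx1 hP₂ hconn
  have hmdP : m ∈ P₂ ↔ d₁ ∈ P₂ := by
    have h1 : ∀ z ∈ K.E, (z ∈ P₂ ↔ z ∈ P) := fun z hz ↦ by
      rw [← hP₂U]; exact ⟨fun h ↦ ⟨h, hz⟩, fun h ↦ h.1⟩
    rw [h1 m hmK, h1 d₁ hdK]
    exact hPser m d₁ hmn hser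
  have hLP : ∀ z ∈ L \ {l₁}, (z ∈ P₂ ↔ m ∈ P₂) := fun z hz ↦
    hP₂par z m (hLnl z hz) (by rw [hclL z hz, hclL m hmL])
  have hcoK : K.co.E ⊆ K.E := K✶.si_ground_subset
  have hnotboth : ¬ (m ∈ K.co.E ∧ d₁ ∈ K.co.E) := by
    rintro ⟨h1, h2⟩
    have := parallelRep_congr hmn hser
    rw [parallelRep_of_mem_si h1, parallelRep_of_mem_si h2] at this
    exact hmd this
  have hUP : U ⊆ P₂ := by
    rw [← hPU, ← hP₂U]
    exact inter_subset_left.trans inter_subset_left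
  have hVQ : K.co.E \ U ⊆ (M.E \ {l₁}) \ P₂ := fun z hz ↦ ⟨hKE (hcoK hz.1), fun h ↦ hz.2 (by
    rw [← hPU, ← hP₂U]
    exact ⟨⟨h, hcoK hz.1⟩, hz.1⟩)⟩
  have hP₂' : P₂ ⊆ M.E \ {l₁} := hP₂
  -- The side of the lifted separation that contains m contains all of L \ l₁ (parallel to m) and d₁
  -- (in series with m); it plays the role of S.
  by_cases hmP : m ∈ P₂
  · refine fin k P₂ ((M.E \ {l₁}) \ P₂) U m hk (union_sdiff_cancel hP₂') disjoint_sdiff_right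
      (fun z hz ↦ (hLP z hz).2 hmP) (hmdP.1 hmP) hUP hU1 (hU2.trans (encard_le_encard hVQ))
      (fun z hz ↦ hKL z (hcoK (hU hz.1)) hz.2) (fun h ↦ hnotboth ⟨hU h.1, hU h.2⟩) hsum
  · refine fin k ((M.E \ {l₁}) \ P₂) P₂ (K.co.E \ U) m hk (sdiff_union_of_subset hP₂')
      disjoint_sdiff_left
      (fun z hz ↦ ⟨⟨hLE hz.1, hz.2⟩, fun h ↦ hmP ((hLP z hz).1 h)⟩) ⟨hd₁', fun h ↦ hmP (hmdP.2 h)⟩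
      hVQ hU2 (hU1.trans (encard_le_encard hUP))
      (fun z hz ↦ hKL z (hcoK hz.1.1) hz.2) (fun h ↦ hnotboth ⟨h.1.1, h.2.1⟩) (by omega)

end Cosimple

end Matroid

namespace Matroid

variable {α : Type*} {M N : Matroid α} {X Y X' Y' Z C D W K L F : Set α} {e f p q x s : α}

/-! ### Uncrossing a minimal vertical 3-separation with another one. -/

section Crossing

lemma IsNConnected.subset_closure_pair [M.Finite] (hM : M.IsNConnected 3) (hE : 4 ≤ M.E.encard)
    (hL : L ⊆ M.E) (hr : M.rkNat L ≤ 2) (hp : p ∈ L) (hq : q ∈ L) (hpq : p ≠ q) :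
    L ⊆ M.closure {p, q} :=
  subset_closure_of_rkNat_le (pair_subset hp hq) hL
    (by rwa [hM.rkNat_pair hE (hL hp) (hL hq) hpq])

/-- A flat containing two elements of a line contains the line. -/
lemma IsNConnected.subset_of_closure_eq [M.Finite] (hM : M.IsNConnected 3)
    (hE : 4 ≤ M.E.encard) (hL : L ⊆ M.E) (hr : M.rkNat L ≤ 2) (hF : M.closure F = F)
    (hp : p ∈ L) (hq : q ∈ L) (hpq : p ≠ q) (hpF : p ∈ F) (hqF : q ∈ F) : L ⊆ F := by
  rw [← hF]
  exact (hM.subset_closure_pair hE hL hr hp hq hpq).trans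
    (M.closure_subset_closure (pair_subset hpF hqF))

/-- Uncrossing: 3-connectivity gives λ(X ∪ Y) ≥ 2, and submodularity leaves at most 2 for λ(X ∩ Y).
-/
lemma IsNConnected.rkSum_inter_le [M.Finite] (hM : M.IsNConnected 3) (hX : X ⊆ M.E)
    (hY : Y ⊆ M.E) (h1 : M.rkSum X ≤ M.rkNat M.E + 2) (h2 : M.rkSum Y ≤ M.rkNat M.E + 2)
    (h3 : (X ∪ Y).Nontrivial) (h4 : (M.E \ (X ∪ Y)).Nontrivial) :
    M.rkSum (X ∩ Y) ≤ M.rkNat M.E + 2 := by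
  have h5 := M.rkSum_submod X Y
  have h6 := hM.add_two_le (union_subset hX hY) h3 h4
  omega

/-- A vertical `3`-separation whose right side together with `x` is a flat. -/
structure IsClosedVertSep (M : Matroid α) (X : Set α) (x : α) (Y : Set α) : Prop
    extends M.IsVertSep X x Y where
  closed : M.closure (insert x Y) = insert x Y

/-- A closed vertical `3`-separation `(X, x, Y)` with `x ∈ K`, where `K` satisfies the
orthogonality property of a cocircuit, such that `X` contains no side of a vertical
`3`-separation at an element of `X ∩ K`. -/
structure IsMinVertSep (M : Matroid α) (K X : Set α) (x : α) (Y : Set α) : Prop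
    extends M.IsClosedVertSep X x Y where
  mem : x ∈ K
  orth : ∀ z ∈ K, ∀ Z, z ∈ M.closure Z → (Z ∩ K).Nonempty
  min : ∀ s ∈ X, s ∈ K → ∀ Z W, M.IsVertSep Z s W → ¬ Z ⊆ X

lemma IsVertSep.part (h : M.IsVertSep X x Y) (z : α) :
    (z ∈ M.E ↔ z ∈ X ∨ z ∈ Y ∨ z = x) ∧ (z ∈ X → z ∉ Y) ∧ (z ∈ X → z ≠ x) ∧ (z ∈ Y → z ≠ x) :=
  ⟨h.mem_iff z, h.notMem_of_mem, fun h1 h2 ↦ h.notMem_left (h2 ▸ h1),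
    fun h1 h2 ↦ h.notMem_right (h2 ▸ h1)⟩

lemma IsVertSep.nontrivial_left [M.Finite] (h : M.IsVertSep X x Y) : X.Nontrivial :=
  nontrivial_of_two_le_rkNat (h.three_le_left.trans' (by norm_num))

lemma IsVertSep.nontrivial_right [M.Finite] (h : M.IsVertSep X x Y) : Y.Nontrivial :=
  h.symm.nontrivial_left

lemma IsClosedVertSep.notMem_closure (h : M.IsClosedVertSep X x Y) (hs : s ∈ X) :
    s ∉ M.closure (insert x Y) := by
  rw [h.closed]
  have := h.part s
  clear * - this hs
  grind

lemma IsClosedVertSep.mem_of_mem_closure (h : M.IsClosedVertSep X x Y) (hs : s ∈ M.closure Z)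
    (hZ : Z ⊆ insert x Y) : s ∈ insert x Y := by
  rw [← h.closed]
  exact M.closure_subset_closure hZ hs

/-- Otherwise X' lies in the flat Y ∪ x, which does not contain s, although s ∈ cl(X'). -/
lemma IsClosedVertSep.inter_nonempty (h : M.IsClosedVertSep X x Y) (hs : s ∈ X)
    (h' : M.IsVertSep X' s Y') (hx : x ∈ Y') : (X ∩ X').Nonempty := by
  by_contra hne
  rw [not_nonempty_iff_eq_empty, ← disjoint_iff_inter_eq_empty, disjoint_left] at hne
  refine h.notMem_closure hs (M.closure_subset_closure (fun z hz ↦ ?_) h'.mem_left)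
  have h1 := h.part z
  have h2 := h'.part z
  have h3 := @hne z
  clear * - h1 h2 h3 hz hx
  grind

lemma IsClosedVertSep.inter_right_nonempty (h : M.IsClosedVertSep X x Y) (hs : s ∈ X)
    (h' : M.IsVertSep X' s Y') : (X ∩ Y').Nonempty := by
  by_contra hne
  rw [not_nonempty_iff_eq_empty, ← disjoint_iff_inter_eq_empty, disjoint_left] at hne
  refine h.notMem_closure hs (M.closure_subset_closure (fun z hz ↦ ?_) h'.mem_right)
  have h1 := h.part z
  have h2 := h'.part z
  have h3 := @hne z
  clear * - h1 h2 h3 hz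
  grind

lemma IsMinVertSep.exists_mem (h : M.IsMinVertSep K X x Y) : ∃ s ∈ X, s ∈ K := by
  obtain ⟨s, hs⟩ := h.orth x h.mem X h.mem_left
  exact ⟨s, hs.1, hs.2⟩

/-- This is how minimality is used. If Z did not span s, then λ(Z) would be less than λ(Z ∪ s), so
at most 1. Once Z spans s, rank 3 or more would make Z a side of a vertical 3-separation at s inside
X. -/
lemma IsMinVertSep.mem_closure [M.Finite] (hM : M.IsNConnected 3) (h : M.IsMinVertSep K X x Y)
    (hs : s ∈ X) (hsK : s ∈ K) (hZ : Z ⊆ X) (hsZ : s ∉ Z) (hnt : Z.Nontrivial)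
    (h1 : s ∈ M.closure (M.E \ insert s Z)) (h2 : M.rkSum (insert s Z) ≤ M.rkNat M.E + 2) :
    s ∈ M.closure Z ∧ M.rkNat Z ≤ 2 := by
  have hsE := h.subset_left hs
  have hxE := h.mem_ground
  have hx := h.notMem_left
  have hZE := hZ.trans h.subset_left
  have hc : M.E \ Z = insert s (M.E \ insert s Z) := by clear * - hsE hsZ; grind
  have hr : M.rkNat (M.E \ Z) = M.rkNat (M.E \ insert s Z) := by
    rw [hc, rkNat_insert_of_mem_closure h1]
  have h3 := hM.add_two_le hZE hnt
    ⟨s, ⟨hsE, hsZ⟩, x, ⟨hxE, fun h ↦ hx (hZ h)⟩, by rintro rfl; exact hx hs⟩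
  rw [rkSum] at h2 h3
  have h4 : s ∈ M.closure Z := by
    rw [mem_closure_iff_rkNat hsE]
    omega
  refine ⟨h4, not_lt.1 fun h5 ↦ ?_⟩
  rw [rkNat_insert_of_mem_closure h4] at h2
  refine h.min s hs hsK Z _ (isVertSep_of_rkSum_le hM hZE hsE hsZ h4 h1 ?_ h5 ?_) hZ
  · rw [rkSum]
    omega
  · refine h.three_le_right.trans (M.rkNat_mono fun z hz ↦ ⟨h.subset_right hz, ?_⟩)
    rintro (rfl | h6)
    · exact h.notMem_of_mem hs hz
    · exact h.notMem_of_mem (hZ h6) hz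

/-- If the part of `X` on the right side of a vertical `3`-separation at `s` is nonempty, and
the left side has two elements outside of `X`, then this part lies on a line with `s` and `x`. -/
lemma IsVertSep.rkNat_inter_le [M.Finite] (hM : M.IsNConnected 3) (h : M.IsMinVertSep K X x Y)
    (hs : s ∈ X) (hsK : s ∈ K) (h' : M.IsVertSep X' s Y') (hx : x ∈ Y') (hC : (Y ∩ X').Nontrivial) :
    M.rkNat (insert s (insert x (X ∩ Y'))) ≤ 2 := by
  have hE := h.nontrivial_left.mono h.subset_left
  have e1 : insert x X ∩ insert s Y' = insert s (insert x (X ∩ Y')) := by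
    ext z; have h1 := h'.part z; clear * - h1 hs hx; grind
  have e2 : M.E \ (insert x X ∪ insert s Y') = Y ∩ X' := by
    ext z; have h1 := h.part z; have h2 := h'.part z; clear * - h1 h2; grind
  have h1 := hM.rkSum_inter_le (insert_subset h.mem_ground h.subset_left)
    (insert_subset h'.mem_ground h'.subset_right) h.rkSum_insert_left.le
    h'.symm.rkSum_insert_left.le (h.nontrivial_left.mono (by clear * -; grind)) (by rwa [e2])
  rw [e1, rkSum] at h1
  have hB : X ∩ Y' ⊆ M.E := inter_subset_left.trans h.subset_left
  have hsB : s ∉ X ∩ Y' := fun h ↦ h'.notMem_right h.2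
  have hxB : x ∉ X ∩ Y' := fun hh ↦ h.notMem_left hh.1
  set B := X ∩ Y' with hBdef
  -- The set X' spans s and Y spans x, and both avoid B ∪ {s, x}.
  have hr : M.rkNat (M.E \ B) = M.rkNat (M.E \ insert s (insert x B)) := by
    refine rkNat_eq_of_subset_closure (by clear * -; grind) fun z hz ↦ ?_
    by_cases hzs : z = s
    · rw [hzs]
      refine M.closure_subset_closure (fun w hw ↦ ?_) h'.mem_left
      have h2 := h'.part w
      clear * - h2 hw hx; grind
    by_cases hzx : z = x
    · rw [hzx]
      refine M.closure_subset_closure (fun w hw ↦ ?_) h.mem_right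
      have h2 := h.part w
      clear * - h2 hw hs; grind
    exact M.mem_closure_of_mem' ⟨hz.1, by clear * - hz hzs hzx; grind⟩ hz.1
  have h6 := M.rkNat_insert_le s (insert x B)
  obtain hsub | hnt := B.subsingleton_or_nontrivial
  · obtain h0 | ⟨b, hb⟩ := hsub.eq_empty_or_singleton
    · rw [h0, insert_empty_eq]
      exact M.rkNat_pair_le s x
    · have h2 := hM.rkNat_diff_singleton hE (hB (hb ▸ mem_singleton b))
      rw [← hb] at h2
      omega
  · have h2 := hM.add_two_le hB hnt ⟨s, ⟨h'.mem_ground, hsB⟩, x, ⟨h.mem_ground, hxB⟩,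
      by rintro rfl; exact h.notMem_left hs⟩
    rw [rkSum] at h2
    have h3 := M.rkNat_mono (insert_subset_insert (subset_insert x B) : insert s B ⊆ _)
    have h4 : M.rkNat (M.E \ insert s B) ≤ M.rkNat (M.E \ B) :=
      M.rkNat_mono (sdiff_subset_sdiff_right (subset_insert s B))
    have h5 : X' ⊆ M.E \ insert s B := fun z hz ↦ by
      have h2 := h'.part z
      clear * - h2 hz; grind
    have h7 := (h.mem_closure hM hs hsK inter_subset_left hsB hnt
      (M.closure_subset_closure h5 h'.mem_left) (by rw [← hBdef, rkSum]; omega)).2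
    rw [← hBdef] at h7
    omega

/-- If Y ∩ Y' were empty, then Y ⊆ X', and Y' would lie in (X ∩ Y') ∪ {s, x}, which has rank at most
2. -/
lemma IsVertSep.inter_inter_nonempty [M.Finite] (hM : M.IsNConnected 3)
    (h : M.IsMinVertSep K X x Y)
    (hs : s ∈ X) (hsK : s ∈ K) (h' : M.IsVertSep X' s Y') (hx : x ∈ Y') :
    (Y ∩ Y').Nonempty := by
  by_contra hne
  rw [not_nonempty_iff_eq_empty, ← disjoint_iff_inter_eq_empty, disjoint_left] at hne
  have hYX : Y ⊆ Y ∩ X' := fun z hz ↦ by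
    have h1 := h.part z
    have h2 := h'.part z
    have h3 := @hne z
    clear * - h1 h2 h3 hz hs; grind
  have h1 := h'.rkNat_inter_le hM h hs hsK hx (h.nontrivial_right.mono hYX)
  have h2 : Y' ⊆ insert s (insert x (X ∩ Y')) := fun z hz ↦ by
    have h1 := h.part z
    have h2 := h'.part z
    have h3 := @hne z
    clear * - h1 h2 h3 hz hs; grind
  have h3 := M.rkNat_mono h2
  have h4 := h'.three_le_right
  omega

/-- If the part of `X` on the left side of a vertical `3`-separation at `s` has two elements,
then it lies on a line with `s`. -/
lemma IsVertSep.rkNat_inter_left_le [M.Finite] (hM : M.IsNConnected 3)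
    (h : M.IsMinVertSep K X x Y) (hs : s ∈ X) (hsK : s ∈ K) (h' : M.IsVertSep X' s Y')
    (hx : x ∈ Y') (hA : (X ∩ X').Nontrivial) :
    s ∈ M.closure (X ∩ X') ∧ M.rkNat (X ∩ X') ≤ 2 := by
  have e1 : X ∩ insert s X' = insert s (X ∩ X') := by
    ext z; clear * - hs; grind
  obtain ⟨d, hd⟩ := h'.inter_inter_nonempty hM h hs hsK hx
  have hdx : d ≠ x := fun h1 ↦ h.notMem_right (h1 ▸ hd.1)
  have h1 := hM.rkSum_inter_le h.subset_left
    (insert_subset h'.mem_ground h'.subset_left) h.rkSum_left.le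
    h'.rkSum_insert_left.le (h.nontrivial_left.mono subset_union_left)
    ⟨d, ⟨h.subset_right hd.1, ?_⟩, x, ⟨h.mem_ground, ?_⟩, hdx⟩
  · rw [e1] at h1
    refine h.mem_closure hM hs hsK inter_subset_left (fun h ↦ h'.notMem_left h.2) hA ?_ h1
    refine M.closure_subset_closure (fun z hz ↦ ?_) h'.mem_right
    have h2 := h'.part z
    clear * - h2 hz; grind
  · have h1 := h.part d
    have h2 := h'.part d
    clear * - h1 h2 hd hs; grind
  · have h1 := h.part x
    have h2 := h'.part x
    clear * - h1 h2 hx hs; grind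

end Crossing

end Matroid

namespace Matroid

variable {α : Type*} {M : Matroid α} {X₁ Y₁ X₂ Y₂ Y L : Set α} {a m x s : α}

/-! ### Two vertical 3-separations at points of a common line. -/

section Line

/-- Two vertical `3`-separations at elements `s`, `m` of a line `L` containing `x`, where the
ground set is partitioned into `{a}`, `L` and `Y`, such that `a` and `L` are on different sides of
both separations. -/
structure IsLineSepPair (M : Matroid α) (L Y : Set α) (a x : α) (X₁ : Set α) (s : α) (Y₁ : Set α)
    (X₂ : Set α) (m : α) (Y₂ : Set α) : Prop where
  rkNat_line : M.rkNat L = 2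
  closure_line : M.closure L = L
  ground : ∀ z, (z ∈ M.E ↔ z = a ∨ z ∈ L ∨ z ∈ Y) ∧ (z ∈ L → z ≠ a) ∧ (z ∈ Y → z ≠ a) ∧
    (z ∈ L → z ∉ Y)
  notMem_closure : ∀ z ∈ L, z ≠ x → z ∉ M.closure Y
  x_mem : x ∈ L
  s_mem : s ∈ L
  m_mem : m ∈ L
  x_ne_s : x ≠ s
  x_ne_m : x ≠ m
  s_ne_m : s ≠ m
  sep₁ : M.IsVertSep X₁ s Y₁
  sep₂ : M.IsVertSep X₂ m Y₂
  line₁ : ∀ z ∈ L, z ≠ s → z ∈ Y₁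
  line₂ : ∀ z ∈ L, z ≠ m → z ∈ Y₂
  a_mem₁ : a ∈ X₁
  a_mem₂ : a ∈ X₂

lemma IsLineSepPair.symm (h : M.IsLineSepPair L Y a x X₁ s Y₁ X₂ m Y₂) :
    M.IsLineSepPair L Y a x X₂ m Y₂ X₁ s Y₁ :=
  ⟨h.1, h.2, h.3, h.4, h.5, h.7, h.6, h.9, h.8, h.10.symm, h.12, h.11, h.14, h.13, h.16, h.15⟩

lemma IsLineSepPair.part (h : M.IsLineSepPair L Y a x X₁ s Y₁ X₂ m Y₂) (z : α) :
    ((z ∈ M.E ↔ z = a ∨ z ∈ L ∨ z ∈ Y) ∧ (z ∈ L → z ≠ a) ∧ (z ∈ Y → z ≠ a) ∧ (z ∈ L → z ∉ Y)) ∧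
    ((z ∈ M.E ↔ z ∈ X₁ ∨ z ∈ Y₁ ∨ z = s) ∧ (z ∈ X₁ → z ∉ Y₁) ∧ (z ∈ X₁ → z ≠ s) ∧
      (z ∈ Y₁ → z ≠ s)) ∧
    ((z ∈ M.E ↔ z ∈ X₂ ∨ z ∈ Y₂ ∨ z = m) ∧ (z ∈ X₂ → z ∉ Y₂) ∧ (z ∈ X₂ → z ≠ m) ∧
      (z ∈ Y₂ → z ≠ m)) ∧
    (z = x → z ∈ L) ∧ (z = s → z ∈ L) ∧ (z = m → z ∈ L) ∧ (z ∈ L → z ≠ s → z ∈ Y₁) ∧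
    (z ∈ L → z ≠ m → z ∈ Y₂) ∧ (z = a → z ∈ X₁) ∧ (z = a → z ∈ X₂) ∧ x ≠ s ∧ x ≠ m ∧ s ≠ m :=
  ⟨h.ground z, h.sep₁.part z, h.sep₂.part z, fun hz ↦ hz ▸ h.x_mem, fun hz ↦ hz ▸ h.s_mem,
    fun hz ↦ hz ▸ h.m_mem, h.line₁ z, h.line₂ z, fun hz ↦ hz ▸ h.a_mem₁, fun hz ↦ hz ▸ h.a_mem₂,
    h.x_ne_s, h.x_ne_m, h.s_ne_m⟩

lemma IsLineSepPair.line_subset (h : M.IsLineSepPair L Y a x X₁ s Y₁ X₂ m Y₂) : L ⊆ M.E :=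
  fun z hz ↦ ((h.ground z).1).2 (.inr (.inl hz))

lemma IsLineSepPair.subset_closure [M.Finite] (hM : M.IsNConnected 3) (hE : 4 ≤ M.E.encard)
    (h : M.IsLineSepPair L Y a x X₁ s Y₁ X₂ m Y₂) {Z : Set α} (hs : s ∈ M.closure Z)
    (hm : m ∈ M.closure Z) : L ⊆ M.closure Z :=
  hM.subset_of_closure_eq hE h.line_subset h.rkNat_line.le (M.closure_closure Z) h.s_mem h.m_mem
    h.s_ne_m hs hm

/-- Otherwise X₁ ⊆ X₂, so X₂ spans both s and m, hence L. Moving L over to X₂ leaves only Y₂ ∩ Y on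
the other side. If that has two elements, 3-connectivity makes it span Y₂, and so s ∈ cl(Y), which
is excluded. -/
lemma IsLineSepPair.inter_nonempty [M.Finite] (hM : M.IsNConnected 3) (hE : 4 ≤ M.E.encard)
    (h : M.IsLineSepPair L Y a x X₁ s Y₁ X₂ m Y₂) : (X₁ ∩ Y₂).Nonempty := by
  by_contra hne
  rw [not_nonempty_iff_eq_empty, ← disjoint_iff_inter_eq_empty, disjoint_left] at hne
  have hX : X₁ ⊆ X₂ := fun z hz ↦ by
    have h1 := h.part z
    have h2 := @hne z
    clear * - hz h1 h2; grind
  have hL := h.subset_closure hM hE (M.closure_subset_closure hX h.sep₁.mem_left) h.sep₂.mem_left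
  have hr : M.rkNat (X₂ ∪ L) = M.rkNat X₂ := rkNat_eq_of_subset_closure subset_union_left
    (union_subset (M.subset_closure X₂ h.sep₂.subset_left) hL)
  have hc : M.E \ (Y₂ ∩ Y) = X₂ ∪ L := by
    ext z; have h1 := h.part z; clear * - h1; grind
  have hadd := h.sep₂.add_eq
  have h3 := h.sep₂.three_le_right
  have h4 := h.rkNat_line
  obtain hsub | hnt := (Y₂ ∩ Y).subsingleton_or_nontrivial
  · obtain h0 | ⟨d, hd⟩ := hsub.eq_empty_or_singleton
    · have h5 : Y₂ ⊆ L := fun z hz ↦ by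
        have h1 := h.part z
        have h2 : z ∉ Y₂ ∩ Y := by simp [h0]
        clear * - h1 h2 hz; grind
      have := M.rkNat_mono h5
      omega
    · have h5 : Y₂ ⊆ insert d L := fun z hz ↦ by
        have h1 := h.part z
        have h2 : z ∈ Y₂ ∩ Y → z = d := by simp [hd]
        clear * - h1 h2 hz; grind
      have h6 := M.rkNat_mono h5
      have h7 := M.rkNat_insert_le d L
      have hd' : d ∈ Y₂ ∩ Y := by simp [hd]
      have h8 := hM.rkNat_diff_singleton (h.sep₂.nontrivial_left.mono h.sep₂.subset_left)
        (h.sep₂.subset_right hd'.1)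
      rw [← hd, hc] at h8
      omega
  · have h5 := hM.add_two_le (inter_subset_left.trans h.sep₂.subset_right) hnt
      (by rw [hc]; exact h.sep₂.nontrivial_left.mono subset_union_left)
    rw [rkSum, hc] at h5
    have h6 := subset_closure_of_rkNat_le inter_subset_left h.sep₂.subset_right
      (show M.rkNat Y₂ ≤ M.rkNat (Y₂ ∩ Y) by omega)
    exact h.notMem_closure s h.s_mem h.x_ne_s.symm
      (M.closure_subset_closure inter_subset_right (h6 (h.line₂ s h.s_mem h.s_ne_m)))

/-- If X₂ ∩ Y₁ had two elements, uncrossing X₂ ∪ m with Y₁ would bound λ((X₂ ∩ Y₁) ∪ m) by 2. As m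
is also spanned from outside by s and x, the set X₂ ∩ Y₁ ⊆ Y would span m. -/
lemma IsLineSepPair.inter_subsingleton [M.Finite] (hM : M.IsNConnected 3) (hE : 4 ≤ M.E.encard)
    (h : M.IsLineSepPair L Y a x X₁ s Y₁ X₂ m Y₂) : (X₂ ∩ Y₁).Subsingleton := by
  refine not_nontrivial_iff.1 fun hnt ↦ ?_
  obtain ⟨p, hp⟩ := h.inter_nonempty hM hE
  have hpp := h.part p
  have hmE := h.sep₂.mem_ground
  have e1 : insert m X₂ ∩ Y₁ = insert m (X₂ ∩ Y₁) := by
    ext z; have h1 := h.part z; clear * - h1; grind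
  have e2 : M.E \ (insert m X₂ ∪ Y₁) = insert s (X₁ ∩ Y₂) := by
    ext z; have h1 := h.part z; clear * - h1; grind
  have h1 := hM.rkSum_inter_le (insert_subset hmE h.sep₂.subset_left) h.sep₁.subset_right
    h.sep₂.rkSum_insert_left.le h.sep₁.symm.rkSum_left.le
    (h.sep₁.nontrivial_right.mono subset_union_right)
    (by rw [e2]; exact ⟨s, .inl rfl, p, .inr hp, by clear * - hpp hp; grind⟩)
  rw [e1, rkSum] at h1
  have hmQ : m ∉ X₂ ∩ Y₁ := fun hh ↦ h.sep₂.notMem_left hh.1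
  have hsQ : s ∉ X₂ ∩ Y₁ := fun hh ↦ h.sep₁.notMem_right hh.2
  have h2 := hM.add_two_le (inter_subset_left.trans h.sep₂.subset_left) hnt
    ⟨m, ⟨hmE, hmQ⟩, s, ⟨h.sep₁.mem_ground, hsQ⟩, h.s_ne_m.symm⟩
  have h3 : M.E \ (X₂ ∩ Y₁) = insert m (M.E \ insert m (X₂ ∩ Y₁)) := by
    clear * - hmE hmQ; grind
  have h4 : ({s, x} : Set α) ⊆ M.E \ insert m (X₂ ∩ Y₁) := by
    have h1 := h.part s
    have h2 := h.part x
    clear * - h1 h2; grind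
  have h5 : m ∈ M.closure (M.E \ insert m (X₂ ∩ Y₁)) := M.closure_subset_closure h4
    (hM.subset_closure_pair hE h.line_subset h.rkNat_line.le h.s_mem h.x_mem h.x_ne_s.symm h.m_mem)
  rw [rkSum, h3, rkNat_insert_of_mem_closure h5] at h2
  have h6 : m ∈ M.closure (X₂ ∩ Y₁) := by
    rw [mem_closure_iff_rkNat hmE]
    omega
  refine h.notMem_closure m h.m_mem h.x_ne_m.symm (M.closure_subset_closure (fun z hz ↦ ?_) h6)
  have h1 := h.part z
  clear * - h1 hz; grind

/-- X₁ ∪ X₂ spans s and m, hence L, and λ(X₁ ∪ X₂) ≤ 2 by submodularity. Its complement is L ∪ T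
with T = Y₁ ∩ Y₂ ∩ Y; if T had two elements, it would have to span L, contrary to T ⊆ Y. A singleton
T fails by a rank count. -/
lemma IsLineSepPair.notMem [M.Finite] (hM : M.IsNConnected 3) (hE : 4 ≤ M.E.encard)
    (h : M.IsLineSepPair L Y a x X₁ s Y₁ X₂ m Y₂) : ∀ z ∈ Y₁, z ∈ Y₂ → z ∉ Y := by
  by_contra! hT
  obtain ⟨e, he1, he2, heY⟩ := hT
  have heT : e ∈ Y₁ ∩ Y₂ ∩ Y := ⟨⟨he1, he2⟩, heY⟩
  set T := Y₁ ∩ Y₂ ∩ Y with hTdef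
  have hP := h.symm.inter_subsingleton hM hE
  have hS : (X₁ ∩ X₂).Nontrivial := by
    by_contra hS
    rw [not_nontrivial_iff] at hS
    have h1 := M.rkNat_union_le (X₁ ∩ X₂) (X₁ ∩ Y₂)
    have h2 := M.rkNat_le_one_of_subsingleton hS
    have h3 := M.rkNat_le_one_of_subsingleton hP
    have h4 : X₁ ⊆ X₁ ∩ X₂ ∪ X₁ ∩ Y₂ := fun z hz ↦ by
      have h1 := h.part z
      clear * - h1 hz; grind
    have h5 := M.rkNat_mono h4
    have h6 := h.sep₁.three_le_left
    omega
  have h1 := hM.add_two_le (inter_subset_left.trans h.sep₁.subset_left) hS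
    ⟨s, ⟨h.sep₁.mem_ground, fun hh ↦ h.sep₁.notMem_left hh.1⟩, m,
      ⟨h.sep₂.mem_ground, fun hh ↦ h.sep₂.notMem_left hh.2⟩, h.s_ne_m⟩
  have h2 := M.rkSum_submod X₁ X₂
  rw [h.sep₁.rkSum_left, h.sep₂.rkSum_left] at h2
  have e1 : M.E \ (X₁ ∪ X₂) = L ∪ T := by
    ext z; have h1 := h.part z; clear * - h1; grind
  have e2 : M.E \ T = (X₁ ∪ X₂) ∪ L := by
    ext z; have h1 := h.part z; clear * - h1; grind
  have hr : M.rkNat ((X₁ ∪ X₂) ∪ L) = M.rkNat (X₁ ∪ X₂) :=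
    rkNat_eq_of_subset_closure subset_union_left (union_subset
      (M.subset_closure _ (union_subset h.sep₁.subset_left h.sep₂.subset_left))
      (h.subset_closure hM hE (M.closure_subset_closure subset_union_left h.sep₁.mem_left)
        (M.closure_subset_closure subset_union_right h.sep₂.mem_left)))
  have h3 : M.rkNat (X₁ ∪ X₂) + M.rkNat (L ∪ T) ≤ M.rkNat M.E + 2 := by
    rw [← e1]; change M.rkSum _ ≤ _; omega
  have hTE : T ⊆ M.E := inter_subset_left.trans (inter_subset_left.trans h.sep₁.subset_right)
  obtain hsub | hnt := T.subsingleton_or_nontrivial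
  · have hTe : T = {e} := hsub.eq_singleton_of_mem heT
    have h4 := hM.rkNat_diff_singleton (h.sep₁.nontrivial_left.mono h.sep₁.subset_left) (hTE heT)
    rw [← hTe, e2, hr] at h4
    have h5 := rkNat_insert_of_notMem_closure (X := L) (hTE heT)
      (by rw [h.closure_line]; exact fun hh ↦ (h.ground e).2.2.2 hh heY)
    rw [hTe, union_singleton] at h3
    have := h.rkNat_line
    omega
  · have h4 := hM.add_two_le hTE hnt
      (by rw [e2]; exact h.sep₁.nontrivial_left.mono (subset_union_left.trans subset_union_left))
    rw [rkSum, e2, hr] at h4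
    have h5 := subset_closure_of_rkNat_le subset_union_right
      (union_subset h.line_subset hTE) (show M.rkNat (L ∪ T) ≤ M.rkNat T by omega)
    exact h.notMem_closure s h.s_mem h.x_ne_s.symm
      (M.closure_subset_closure inter_subset_right (h5 (.inl h.s_mem)))

/-- Outside L, the side Y₁ consists of Y₁ ∩ Y₂ ∩ Y, which is empty, and X₂ ∩ Y₁, which is a single
element d. -/
lemma IsLineSepPair.exists_eq [M.Finite] (hM : M.IsNConnected 3) (hE : 4 ≤ M.E.encard)
    (h : M.IsLineSepPair L Y a x X₁ s Y₁ X₂ m Y₂) : ∃ d ∈ M.E \ L, Y₁ = insert d (L \ {s}) := by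
  obtain ⟨d, hd⟩ := h.symm.inter_nonempty hM hE
  have hsub := h.inter_subsingleton hM hE
  have hdp := h.part d
  refine ⟨d, by clear * - hd hdp; grind, ?_⟩
  ext z
  have h1 := h.part z
  have h2 := h.notMem hM hE z
  have h3 : z ∈ X₂ ∩ Y₁ → z = d := fun hz ↦ hsub hz hd
  clear * - hd h1 h2 h3
  grind

/-- The complement of the side `Y₁` is nonspanning. -/
lemma IsVertSep.rkNat_compl_lt (h : M.IsVertSep X₁ s Y₁) : M.rkNat (M.E \ Y₁) < M.rkNat M.E := by
  have h1 := h.add_eq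
  have h2 := h.three_le_right
  rw [h.symm.compl_left, h.rkNat_insert_left]
  omega

end Line

end Matroid

namespace Matroid

variable {α : Type*} {M : Matroid α} {X Y X' Y' X₁ Y₁ X₂ Y₂ K L : Set α} {a b c m x s t : α}

/-! ### The case where some X ∩ X' is a single element. -/

section Core

variable [M.Finite]

lemma IsVertSep.exists_isClosedVertSep (hM : M.IsNConnected 3) (h : M.IsVertSep X s Y)
    (hx : x ∈ M.E) (hxs : x ≠ s) : ∃ X' Y', M.IsClosedVertSep X' s Y' ∧ x ∈ Y' := by
  wlog hxY : x ∈ Y generalizing X Y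
  · refine this h.symm ?_
    have h1 := h.part x
    clear * - h1 hx hxs hxY; grind
  obtain ⟨X', Y', h1, -, h2, h3⟩ := h.exists_closed hM
  exact ⟨X', Y', ⟨h1, h3⟩, h2 hxY⟩

/-- X has rank 3, so the flat Y ∪ x is a hyperplane. -/
lemma IsClosedVertSep.isTriad (h : M.IsClosedVertSep X x Y) (hX : X = {a, b, c})
    (hab : a ≠ b) (hac : a ≠ c) (hbc : b ≠ c) : M.IsTriad {a, b, c} := by
  rw [← hX]
  refine ⟨isCocircuit_of_closure_compl h.subset_left ?_ ?_, ?_⟩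
  · rw [h.compl_left, h.closed]
  · rw [h.compl_left, h.rkNat_insert_right]
    have h1 := h.add_eq
    have h2 := h.three_le_left
    have h3 : M.rkNat X ≤ 3 := by
      rw [hX]
      exact (M.rkNat_insert_le _ _).trans (Nat.succ_le_succ (M.rkNat_pair_le _ _))
    omega
  · rw [hX]
    exact encard_eq_three.2 ⟨a, b, c, hab, hac, hbc, rfl⟩

/-- The contradiction when the left side of some vertical `3`-separation at `s` contains only
one element of `X`. -/
lemma IsMinVertSep.false_of_subsingleton (hM : M.IsNConnected 3) (hE : 4 ≤ M.E.encard)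
    (h : M.IsMinVertSep K X x Y) (hvs : ∀ s ∈ X, s ∈ K → ∃ X' Y', M.IsVertSep X' s Y')
    (hfan : ∀ x₁ x₂ x₃ x₄, M.IsFourElementFan x₁ x₂ x₃ x₄ → x₁ ∈ K → x₃ ∈ K → x₂ ∈ X →
      ∃ X' Y', M.IsVertSep X' x₂ Y')
    (hco : ¬ (M ／ {x}).si.co.IsNConnected 3)
    (hs : s ∈ X) (hsK : s ∈ K) (h' : M.IsClosedVertSep X' s Y') (hx : x ∈ Y')
    (hA : (X ∩ X').Subsingleton) : False := by
  obtain ⟨a, ha⟩ := h.inter_nonempty hs h'.toIsVertSep hx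
  have hA' : ∀ z ∈ X, z ∈ X' → z = a := fun z h1 h2 ↦ hA ⟨h1, h2⟩ ha
  have hxs : x ≠ s := fun hh ↦ h.notMem_left (hh ▸ hs)
  have hC : (Y ∩ X').Nontrivial := by
    have h1 := M.rkNat_union_le (X ∩ X') (Y ∩ X')
    have h2 := M.rkNat_le_one_of_subsingleton hA
    have h3 : X' ⊆ X ∩ X' ∪ Y ∩ X' := fun z hz ↦ by
      have h1 := h.part z
      have h2 := h'.part z
      clear * - h1 h2 hz hx; grind
    have h4 := M.rkNat_mono h3
    have h5 := h'.three_le_left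
    exact nontrivial_of_two_le_rkNat (M := M) (by omega)
  have hLr := h'.rkNat_inter_le hM h hs hsK hx hC
  set L := insert s (insert x (X ∩ Y')) with hLdef
  have hmemL : ∀ z, z ∈ L ↔ z = s ∨ z = x ∨ (z ∈ X ∧ z ∈ Y') := fun z ↦ by
    simp [hLdef]
  clear_value L
  have hp : ∀ z, (z ∈ L ↔ z = s ∨ z = x ∨ (z ∈ X ∧ z ∈ Y')) ∧
      ((z ∈ M.E ↔ z ∈ X ∨ z ∈ Y ∨ z = x) ∧ (z ∈ X → z ∉ Y) ∧ (z ∈ X → z ≠ x) ∧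
        (z ∈ Y → z ≠ x)) ∧
      ((z ∈ M.E ↔ z ∈ X' ∨ z ∈ Y' ∨ z = s) ∧ (z ∈ X' → z ∉ Y') ∧ (z ∈ X' → z ≠ s) ∧
        (z ∈ Y' → z ≠ s)) ∧ (z = s → z ∈ X) ∧ (z = x → z ∈ Y') ∧ (z = a → z ∈ X ∧ z ∈ X') ∧
        (z ∈ X → z ∈ X' → z = a) ∧ x ≠ s :=
    fun z ↦ ⟨hmemL z, h.part z, h'.part z, fun e ↦ e ▸ hs, fun e ↦ e ▸ hx, fun e ↦ e ▸ ha,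
      hA' z, hxs⟩
  have hLE : L ⊆ M.E := fun z hz ↦ by
    have h1 := hp z
    clear * - h1 hz; grind
  have hsL : s ∈ L := (hmemL s).2 (.inl rfl)
  have hxL : x ∈ L := (hmemL x).2 (.inr (.inl rfl))
  have hLr2 : M.rkNat L = 2 := by
    refine hLr.antisymm ?_
    rw [← hM.rkNat_pair hE h.mem_ground h'.mem_ground hxs]
    exact M.rkNat_mono (pair_subset hxL hsL)
  -- cl(L) stays in the flat Y' ∪ s. It cannot meet Y: a point of Y together with x would pull the
  -- whole line, including s ∈ X, into the flat Y ∪ x.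
  have hLcl : M.closure L = L := by
    refine subset_antisymm (fun z hz ↦ ?_) (M.subset_closure L hLE)
    have h1 := hp z
    have h2 : z ∈ insert s Y' := h'.mem_of_mem_closure hz fun w hw ↦ by
      have h1 := hp w
      clear * - h1 hw; grind
    have h3 : z ∉ Y := fun hzY ↦ by
      have h4 := hM.subset_of_closure_eq hE (M.closure_subset_ground L)
        (by rw [rkNat_closure, hLr2]) h.closed hz (M.mem_closure_of_mem' hxL h.mem_ground)
        (h1.2.1.2.2.2 hzY) (.inr hzY) (.inl rfl)
      have h5 := h4 (M.mem_closure_of_mem' hsL h'.mem_ground)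
      have h6 := hp s
      clear * - h5 h6; grind
    have h4 := M.closure_subset_ground _ hz
    clear * - h1 h2 h3 h4; grind
  have hnotY : ∀ z ∈ L, z ≠ x → z ∉ M.closure Y := fun z hz hzx hzY ↦ by
    refine h.notMem_closure (s := z) ?_ (M.closure_subset_closure (subset_insert _ _) hzY)
    have h1 := hp z
    clear * - h1 hz hzx; grind
  -- a second vertical separation
  obtain ⟨m, hmX, hmY, X₂, Y₂, h₂⟩ : ∃ m ∈ X, m ∈ Y' ∧ ∃ X₂ Y₂, M.IsVertSep X₂ m Y₂ := by
    by_cases hBK : ∃ m ∈ X, m ∈ Y' ∧ m ∈ K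
    · obtain ⟨m, h1, h2, h3⟩ := hBK
      exact ⟨m, h1, h2, hvs m h1 h3⟩
    -- With no element of K in X ∩ Y', orthogonality at s forces X ∩ Y' = {b}, since two elements
    -- would span s. Then (x, b, s, a) is a fan with triad X, and `hfan` gives the separation at b.
    push Not at hBK
    obtain ⟨b, hbX, hbY⟩ := h.inter_right_nonempty hs h'.toIsVertSep
    have hB : ∀ z ∈ X, z ∈ Y' → z = b := by
      by_contra! hcon
      obtain ⟨z, h1, h2, h3⟩ := hcon
      obtain ⟨w, hw, hwK⟩ := h.orth s hsK {z, b} (hM.subset_closure_pair hE hLE hLr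
        ((hmemL z).2 (.inr (.inr ⟨h1, h2⟩))) ((hmemL b).2 (.inr (.inr ⟨hbX, hbY⟩))) h3 hsL)
      obtain rfl | rfl := hw
      · exact hBK _ h1 h2 hwK
      · exact hBK _ hbX hbY hwK
    have hbp := hp b
    have hap := hp a
    have hbL : b ∈ L := (hmemL b).2 (.inr (.inr ⟨hbX, hbY⟩))
    have hxb : x ≠ b := by clear * - hbp hbX; grind
    have hbs : b ≠ s := by clear * - hbp hbY; grind
    have hab : a ≠ b := by clear * - hbp hbY; grind
    have has : a ≠ s := by clear * - hap; grind
    have hax : a ≠ x := by clear * - hap; grind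
    refine ⟨b, hbX, hbY, hfan x b s a ⟨by simp [hxb, hxs, hax.symm, hbs, hab.symm, has.symm],
      ?_, ?_⟩ h.mem hsK hbX⟩
    · refine hM.isTriangle hE hxb hxs hbs ?_ ?_
      · rintro z (rfl | rfl | rfl)
        exacts [hLE hxL, hLE hbL, hLE hsL]
      · refine (M.rkNat_mono ?_).trans hLr
        rintro z (rfl | rfl | rfl)
        exacts [hxL, hbL, hsL]
    · refine h.isTriad ?_ hbs hab.symm has.symm
      ext z
      have h1 := hp z
      have h2 := hB z
      simp only [mem_insert_iff, mem_singleton_iff]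
      clear * - h1 h2 hbX; grind
  have hmp := hp m
  have hmx : x ≠ m := by clear * - hmp hmX; grind
  have hsm : s ≠ m := by clear * - hmp hmY; grind
  have hmL : m ∈ L := (hmemL m).2 (.inr (.inr ⟨hmX, hmY⟩))
  obtain ⟨X₂, Y₂, h₂, hx₂⟩ := h₂.exists_isClosedVertSep hM h.mem_ground hmx
  have hL₂ := hM.subset_of_closure_eq hE hLE hLr h₂.closed hmL hxL hmx.symm (.inl rfl) (.inr hx₂)
  have ha₂ : a ∈ X₂ := by
    obtain ⟨z, hz⟩ := h.inter_nonempty hmX h₂.toIsVertSep hx₂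
    have h1 := hp z
    have h2 : z ∉ L := fun hzL ↦ by
      have h3 := h₂.part z
      have h4 := hL₂ hzL
      clear * - hz h3 h4; grind
    have h5 : z = a := by clear * - h1 h2 hz; grind
    exact h5 ▸ hz.2
  have hpair : M.IsLineSepPair L Y a x X' s Y' X₂ m Y₂ := by
    refine ⟨hLr2, hLcl, fun z ↦ ?_, hnotY, hxL, hsL, hmL, hxs, hmx, hsm, h'.toIsVertSep,
      h₂.toIsVertSep, fun z hz hzs ↦ ?_, fun z hz hzm ↦ (hL₂ hz).resolve_left hzm, ha.2, ha₂⟩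
    · have h1 := hp z
      clear * - h1; grind
    · have h1 := hp z
      clear * - h1 hz hzs; grind
  obtain ⟨d₁, hd₁, e₁⟩ := hpair.exists_eq hM hE
  obtain ⟨d₂, hd₂, e₂⟩ := hpair.symm.exists_eq hM hE
  have hap := hp a
  -- For the point x the required set is (L \ x) ∪ a, which is X itself; for s and m it is Y' and
  -- Y₂.
  refine hco (isNConnected_co_si_contract hM hE hLr2 hLcl hxL hsL hmL hxs hmx hsm (d₁ := a)
    (by clear * - hap; grind) hd₁ hd₂ ?_ (e₁ ▸ h'.rkNat_compl_lt) (e₂ ▸ h₂.rkNat_compl_lt))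
  convert h.symm.rkNat_compl_lt using 3
  ext z
  have h1 := hp z
  clear * - h1; grind

end Core

end Matroid

namespace Matroid

variable {α : Type*} {M : Matroid α} {X Y X' Y' X₁ Y₁ X₂ Y₂ K L : Set α} {a b c m x z s t : α}

/-! ### The case where every X ∩ X' has at least two elements, and the final contradiction. -/

section Core

variable [M.Finite]

/-- cl(X ∩ X') is a line through s; a second point of it in the flat Y' ∪ s would pull in X ∩ X',
which avoids that flat. -/
lemma IsMinVertSep.notMem_closure_inter (hM : M.IsNConnected 3) (hE : 4 ≤ M.E.encard)
    (h : M.IsMinVertSep K X x Y) (hs : s ∈ X) (hsK : s ∈ K) (h' : M.IsClosedVertSep X' s Y')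
    (hx : x ∈ Y') (hA : (X ∩ X').Nontrivial) (hz : z ∈ Y') : z ∉ M.closure (X ∩ X') := by
  intro hzc
  obtain ⟨h1, h2⟩ := h'.rkNat_inter_left_le hM h hs hsK hx hA
  obtain ⟨a, ha⟩ := hA.nonempty
  have h3 := hM.subset_of_closure_eq hE (M.closure_subset_ground _) (by rwa [rkNat_closure])
    h'.closed h1 hzc (fun hh ↦ h'.notMem_right (hh ▸ hz)) (.inl rfl) (.inr hz)
    (M.mem_closure_of_mem' ha (h.subset_left ha.1))
  have h4 := h'.part a
  clear * - h3 h4 ha; grind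

/-- Otherwise both (X ∩ X') ∪ s and (X ∩ Y') ∪ {s, x} lie on lines. Orthogonality gives t ∈ X ∩ X' ∩
K with a closed separation (X₂, t, Y₂). If s ∈ Y₂, the flat Y₂ ∪ t contains both lines, hence X,
though X₂ meets X. If s ∈ X₂, some b ∈ X ∩ Y' is in Y₂, and b and x pull s into the flat Y₂ ∪ t. -/
lemma IsMinVertSep.inter_right_subsingleton (hM : M.IsNConnected 3) (hE : 4 ≤ M.E.encard)
    (h : M.IsMinVertSep K X x Y) (hvs : ∀ s ∈ X, s ∈ K → ∃ X' Y', M.IsVertSep X' s Y')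
    (hall : ∀ t ∈ X, t ∈ K → ∀ X' Y', M.IsClosedVertSep X' t Y' → x ∈ Y' → (X ∩ X').Nontrivial)
    (hs : s ∈ X) (hsK : s ∈ K) (h' : M.IsClosedVertSep X' s Y') (hx : x ∈ Y') :
    (Y ∩ X').Subsingleton := by
  refine not_nontrivial_iff.1 fun hC ↦ ?_
  have hA := hall s hs hsK X' Y' h' hx
  obtain ⟨hsA, hAr⟩ := h'.rkNat_inter_left_le hM h hs hsK hx hA
  have hBr := h'.rkNat_inter_le hM h hs hsK hx hC
  obtain ⟨t, ⟨htX, htX'⟩, htK⟩ := h.orth s hsK _ hsA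
  obtain ⟨b, hbX, hbY⟩ := h.inter_right_nonempty hs h'.toIsVertSep
  have htx : x ≠ t := fun hh ↦ h.notMem_left (hh ▸ htX)
  have hts : t ≠ s := fun hh ↦ h'.notMem_left (hh ▸ htX')
  have hxs : x ≠ s := fun hh ↦ h.notMem_left (hh ▸ hs)
  obtain ⟨X₂, Y₂, h₀⟩ := hvs t htX htK
  obtain ⟨X₂, Y₂, h₂, hx₂⟩ := h₀.exists_isClosedVertSep hM h.mem_ground htx
  have hA₂ := hall t htX htK X₂ Y₂ h₂ hx₂
  have htA₂ := (h₂.rkNat_inter_left_le hM h htX htK hx₂ hA₂)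
  have hAE : M.closure (X ∩ X') ⊆ M.E := M.closure_subset_ground _
  have hAA : X ∩ X' ⊆ M.closure (X ∩ X') :=
    M.subset_closure _ (inter_subset_left.trans h.subset_left)
  have hBE : insert s (insert x (X ∩ Y')) ⊆ M.E := insert_subset h'.mem_ground
    (insert_subset h.mem_ground (inter_subset_left.trans h.subset_left))
  have hAr' : M.rkNat (M.closure (X ∩ X')) ≤ 2 := by rwa [rkNat_closure]
  have hs₂ := (h₂.part s).1.1 h'.mem_ground
  rcases hs₂ with hs₂ | hs₂ | hs₂
  · have hb₂ : b ∈ Y₂ := by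
      have h1 : b ∉ X₂ := fun hb ↦ by
        refine h.notMem_closure_inter hM hE hs hsK h' hx hA hbY
          (hM.subset_of_closure_eq hE (M.closure_subset_ground (X ∩ X₂)) (L := M.closure (X ∩ X₂))
          (by rw [rkNat_closure]; exact htA₂.2) (M.closure_closure _) (p := s) (q := t)
          (M.mem_closure_of_mem' ⟨hs, hs₂⟩ h'.mem_ground) htA₂.1 hts.symm hsA
          (hAA ⟨htX, htX'⟩) (M.mem_closure_of_mem' ⟨hbX, hb⟩ (h.subset_left hbX)))
      have h2 : b ≠ t := by
        rintro rfl
        exact h'.notMem_of_mem htX' hbY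
      exact (((h₂.part b).1.1 (h.subset_left hbX)).resolve_left h1).resolve_right h2
    have h3 := hM.subset_of_closure_eq hE hBE hBr h₂.closed (p := b) (q := x) (by simp [hbX, hbY])
      (by simp) (fun hh ↦ h.notMem_left (hh ▸ hbX)) (.inr hb₂) (.inr hx₂) (.inl rfl)
    exact h₂.notMem_closure hs₂ (by rwa [h₂.closed])
  · have h1 := hM.subset_of_closure_eq hE hAE hAr' h₂.closed hsA (hAA ⟨htX, htX'⟩) hts.symm
      (.inr hs₂) (.inl rfl)
    have h2 := hM.subset_of_closure_eq hE hBE hBr h₂.closed (p := s) (q := x) (by simp)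
      (by simp) hxs.symm (.inr hs₂) (.inr hx₂)
    obtain ⟨w, hw⟩ := hA₂.nonempty
    have h3 := h'.part w
    have h4 := h₂.part w
    have h5 := @h1 w
    have h6 := @h2 w
    have h7 := @hAA w
    have h8 := h.subset_left hw.1
    simp only [mem_insert_iff, mem_inter_iff] at h5 h6 h7
    clear * - h3 h4 h5 h6 h7 h8 hw
    grind
  · exact hts hs₂.symm

/-- L is (X ∩ X') ∪ s. As X ∩ X' has rank at most 2 and X' has rank at least 3, the set Y ∩ X' is
not empty; its only element is c. -/
lemma IsMinVertSep.exists_line (hM : M.IsNConnected 3) (hE : 4 ≤ M.E.encard)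
    (h : M.IsMinVertSep K X x Y) (hvs : ∀ s ∈ X, s ∈ K → ∃ X' Y', M.IsVertSep X' s Y')
    (hall : ∀ t ∈ X, t ∈ K → ∀ X' Y', M.IsClosedVertSep X' t Y' → x ∈ Y' → (X ∩ X').Nontrivial)
    (hs : s ∈ X) (hsK : s ∈ K) (h' : M.IsClosedVertSep X' s Y') (hx : x ∈ Y') :
    ∃ L, ∃ c ∈ Y, M.rkNat L = 2 ∧ M.closure L = L ∧ s ∈ L ∧ L ⊆ X ∧ (L \ {s}).Nontrivial ∧
      s ∈ M.closure (L \ {s}) ∧ X' = insert c (L \ {s}) := by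
  have hC := h.inter_right_subsingleton hM hE hvs hall hs hsK h' hx
  have hA := hall s hs hsK X' Y' h' hx
  obtain ⟨hsA, hAr⟩ := h'.rkNat_inter_left_le hM h hs hsK hx hA
  have hX' : X' ⊆ X ∩ X' ∪ Y ∩ X' := fun z hz ↦ by
    have h1 := h.part z
    have h2 := h'.part z
    clear * - h1 h2 hz hx; grind
  have hr3 := h'.three_le_left
  have hr4 := M.rkNat_mono hX'
  have hAE : X ∩ X' ⊆ M.E := inter_subset_left.trans h.subset_left
  obtain ⟨c, hc⟩ : (Y ∩ X').Nonempty := by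
    by_contra h0
    rw [not_nonempty_iff_eq_empty] at h0
    rw [h0, union_empty] at hr4
    omega
  have hYX : Y ∩ X' = {c} := hC.eq_singleton_of_mem hc
  rw [hYX] at hX' hr4
  have hXc : X' = insert c (X ∩ X') := by
    have h1 := hc.2
    clear * - hX' h1; grind
  have hsX' := h'.notMem_left
  have hLs : insert s (X ∩ X') \ {s} = X ∩ X' := by clear * - hsX'; grind
  have hr5 := M.rkNat_insert_le c (X ∩ X')
  rw [union_singleton] at hr4
  have hcA : c ∉ M.closure (X ∩ X') := fun hcc ↦ by
    rw [rkNat_insert_of_mem_closure hcc] at hr4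
    omega
  have hXX : X ∩ X' ⊆ M.closure (X ∩ X') := M.subset_closure _ hAE
  refine ⟨insert s (X ∩ X'), c, hc.1, ?_, ?_, mem_insert _ _, insert_subset hs inter_subset_left,
    by rwa [hLs], by rwa [hLs], by rwa [hLs]⟩
  · rw [rkNat_insert_of_mem_closure hsA]
    omega
  · rw [closure_insert_eq_of_mem_closure hsA]
    refine subset_antisymm (fun z hz ↦ ?_) (insert_subset hsA hXX)
    have h1 := h'.part z
    have h2 := M.closure_subset_ground _ hz
    have h3 := fun hzY ↦ h.notMem_closure_inter hM hE hs hsK h' hx hA (z := z) hzY hz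
    have h4 : z ≠ c := by rintro rfl; exact hcA hz
    have h5 := @hX' z
    clear * - h1 h2 h3 h4 h5; grind

/-- The separation at t yields a line through t, and it must be L again: were s not on it, flatness
of Y₂ ∪ t would put L there, and then flatness of Y' ∪ s would capture the line at t, although t ∈
X'. -/
lemma IsMinVertSep.rkNat_compl_lt (hM : M.IsNConnected 3) (hE : 4 ≤ M.E.encard)
    (h : M.IsMinVertSep K X x Y) (hvs : ∀ s ∈ X, s ∈ K → ∃ X' Y', M.IsVertSep X' s Y')
    (hall : ∀ t ∈ X, t ∈ K → ∀ X' Y', M.IsClosedVertSep X' t Y' → x ∈ Y' → (X ∩ X').Nontrivial)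
    (hs : s ∈ X) (h' : M.IsClosedVertSep X' s Y')
    (hLr : M.rkNat L = 2) (hLcl : M.closure L = L) (hsL : s ∈ L) (hLX : L ⊆ X)
    (hLX' : X' = insert c (L \ {s})) (hc : c ∈ Y) (htL : t ∈ L) (htK : t ∈ K) (hts : t ≠ s) :
    ∃ d ∈ Y, M.rkNat (M.E \ insert d (L \ {t})) < M.rkNat M.E := by
  have htX := hLX htL
  obtain ⟨X₂, Y₂, h₀⟩ := hvs t htX htK
  obtain ⟨X₂, Y₂, h₂, hx₂⟩ := h₀.exists_isClosedVertSep hM h.mem_ground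
    (fun hh ↦ h.notMem_left (hh ▸ htX))
  obtain ⟨L₂, d, hd, hr₂, hcl₂, htL₂, hL₂X, hnt₂, -, hX₂⟩ :=
    h.exists_line hM hE hvs hall htX htK h₂ hx₂
  have hLE := hLX.trans h.subset_left
  have hL₂E := hL₂X.trans h.subset_left
  have hsL₂ : s ∈ L₂ := by
    by_contra hs₂
    have hsY₂ : s ∈ Y₂ := by
      have h1 := h.part s
      have h2 := h₂.part s
      rw [hX₂] at h2
      clear * - h1 h2 hs hs₂ hd hts; grind
    have h1 := hM.subset_of_closure_eq hE hLE hLr.le h₂.closed hsL htL hts.symm (.inr hsY₂) (.inl rfl)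
    have h3 : ∀ z ∈ L₂, z ≠ t → z ∈ insert s Y' := fun z hz hzt ↦ by
      have h1 := @h1 z
      have h2 := h'.part z
      have h3 := h.part z
      have h4 := h₂.part z
      have h5 := hL₂X hz
      rw [hX₂] at h4
      rw [hLX'] at h2
      clear * - h1 h2 h3 h4 h5 hz hzt hc; grind
    obtain ⟨p, hp, q, hq, hpq⟩ := hnt₂
    have h4 := hM.subset_of_closure_eq hE hL₂E hr₂.le h'.closed hp.1 hq.1 hpq (h3 p hp.1 hp.2)
      (h3 q hq.1 hq.2) htL₂
    have h5 := h'.part t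
    rw [hLX'] at h5
    clear * - h4 h5 htL hts; grind
  have hLL : L₂ = L := subset_antisymm
    (hM.subset_of_closure_eq hE hL₂E hr₂.le hLcl hsL₂ htL₂ hts.symm hsL htL)
    (hM.subset_of_closure_eq hE hLE hLr.le hcl₂ hsL htL hts.symm hsL₂ htL₂)
  refine ⟨d, hd, ?_⟩
  rw [← hLL, ← hX₂]
  exact h₂.symm.rkNat_compl_lt

/-- In the main case s and a further t ∈ L ∩ K already provide two of the three required sets. The
third comes from another element of L ∩ K, or else from the fan (s, e, t, c) with L = {s, t, e}. -/
theorem IsMinVertSep.false (hM : M.IsNConnected 3) (hE : 4 ≤ M.E.encard)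
    (h : M.IsMinVertSep K X x Y) (hvs : ∀ s ∈ X, s ∈ K → ∃ X' Y', M.IsVertSep X' s Y')
    (hfan : ∀ x₁ x₂ x₃ x₄, M.IsFourElementFan x₁ x₂ x₃ x₄ → x₁ ∈ K → x₃ ∈ K → x₂ ∈ X →
      ∃ X' Y', M.IsVertSep X' x₂ Y')
    (hco : ∀ s ∈ insert x X, s ∈ K → ¬ (M ／ {s}).si.co.IsNConnected 3) : False := by
  by_cases hall : ∀ t ∈ X, t ∈ K → ∀ X' Y', M.IsClosedVertSep X' t Y' → x ∈ Y' →
    (X ∩ X').Nontrivial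
  swap
  · push Not at hall
    obtain ⟨s, hs, hsK, X', Y', h', hx, hA⟩ := hall
    exact h.false_of_subsingleton hM hE hvs hfan (hco x (.inl rfl) h.mem) hs hsK h' hx
      hA
  obtain ⟨s, hs, hsK⟩ := h.exists_mem
  obtain ⟨X', Y', h₀⟩ := hvs s hs hsK
  obtain ⟨X', Y', h', hx⟩ := h₀.exists_isClosedVertSep hM h.mem_ground
    (fun hh ↦ h.notMem_left (hh ▸ hs))
  obtain ⟨L, c, hc, hLr, hLcl, hsL, hLX, hLnt, hsc, hX'⟩ := h.exists_line hM hE hvs hall hs hsK h' hx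
  have hLE := hLX.trans h.subset_left
  have hY : ∀ d ∈ Y, d ∈ M.E \ L := fun d hd ↦
    ⟨h.subset_right hd, fun hh ↦ h.notMem_of_mem (hLX hh) hd⟩
  have hrs : M.rkNat (M.E \ insert c (L \ {s})) < M.rkNat M.E := hX' ▸ h'.symm.rkNat_compl_lt
  have hrt := fun t htL htK hts ↦ h.rkNat_compl_lt hM hE hvs hall hs h' hLr hLcl hsL hLX hX' hc
    (t := t) htL htK hts
  obtain ⟨t, ⟨htL, hts⟩, htK⟩ := h.orth s hsK _ hsc
  rw [mem_singleton_iff] at hts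
  obtain ⟨c₂, hc₂, hr₂⟩ := hrt t htL htK hts
  by_cases hu : ∃ u ∈ L, u ∈ K ∧ u ≠ s ∧ u ≠ t
  · obtain ⟨u, huL, huK, hus, hut⟩ := hu
    obtain ⟨c₃, hc₃, hr₃⟩ := hrt u huL huK hus
    exact hco s (.inr hs) hsK (isNConnected_co_si_contract hM hE hLr hLcl hsL htL huL (Ne.symm hts)
      hus.symm hut.symm (hY c hc) (hY c₂ hc₂) (hY c₃ hc₃) hrs hr₂ hr₃)
  push Not at hu
  obtain ⟨e, ⟨heL, hes⟩, het⟩ := hLnt.exists_ne t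
  rw [mem_singleton_iff] at hes
  have hLe : ∀ z ∈ L, z = s ∨ z = t ∨ z = e := by
    by_contra! hcon
    obtain ⟨z, hz, hzs, hzt, hze⟩ := hcon
    obtain ⟨w, hw, hwK⟩ := h.orth s hsK {z, e}
      (hM.subset_closure_pair hE hLE hLr.le hz heL hze hsL)
    obtain rfl | rfl := hw
    · exact hzt (hu _ hz hwK hzs)
    · exact het (hu _ heL hwK hes)
  have hcE := hY c hc
  have hcs : c ≠ s := by rintro rfl; exact hcE.2 hsL
  have hct : c ≠ t := by rintro rfl; exact hcE.2 htL
  have hce : c ≠ e := by rintro rfl; exact hcE.2 heL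
  obtain ⟨P, Q, hPQ⟩ := hfan s e t c ⟨by simp [Ne.symm hes, Ne.symm hts, het,
      hcs.symm, hct.symm, hce.symm], by
    refine hM.isTriangle hE (Ne.symm hes) (Ne.symm hts) het ?_ ?_
    · rintro z (rfl | rfl | rfl)
      exacts [hLE hsL, hLE heL, hLE htL]
    · refine (M.rkNat_mono ?_).trans hLr.le
      rintro z (rfl | rfl | rfl)
      exacts [hsL, heL, htL], by
    refine h'.isTriad ?_ het hce.symm hct.symm
    rw [hX']
    ext z
    have h1 := hLe z
    simp only [mem_insert_iff, mem_singleton_iff, mem_sdiff]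
    clear * - h1 htL heL hts hes; grind⟩ hsK htK (hLX heL)
  obtain ⟨Q, P, hQP, hsP⟩ := hPQ.exists_isClosedVertSep hM (hLE hsL) (Ne.symm hes)
  have hLP := hM.subset_of_closure_eq hE hLE hLr.le hQP.closed heL hsL hes (.inl rfl) (.inr hsP)
  have hp : ∀ z, ((z ∈ M.E ↔ z ∈ Q ∨ z ∈ P ∨ z = e) ∧ (z ∈ Q → z ∉ P) ∧ (z ∈ Q → z ≠ e) ∧
      (z ∈ P → z ≠ e)) ∧ (z ∈ L ↔ z = s ∨ z = t ∨ z = e) := fun z ↦ ⟨hQP.part z, hLe z, by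
    rintro (rfl | rfl | rfl)
    exacts [hsL, htL, heL]⟩
  have htP : t ∈ P := (hLP htL).resolve_left (Ne.symm het)
  have hnot₁ : ∀ z ∈ L, z ≠ s → z ∉ M.closure (M.E \ insert c (L \ {s})) := fun z hz hzs ↦
    hM.notMem_closure_compl_insert hE hLr.le hLE hsL hcE hrs hz hzs
  have hnot₂ : ∀ z ∈ L, z ≠ t → z ∉ M.closure (M.E \ insert c₂ (L \ {t})) := fun z hz hzt ↦
    hM.notMem_closure_compl_insert hE hLr.le hLE htL (hY c₂ hc₂) hr₂ hz hzt
  have hQc : ∀ d l, d ∈ P → Q ⊆ M.E \ insert d (L \ {l}) := fun d l hdP z hz ↦ by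
    have h1 := hp z
    have h2 : d = z → z ∈ P := fun h ↦ h ▸ hdP
    clear * - h1 h2 hz hsP htP; grind
  -- If c ∈ P, then Q would avoid (L \ s) ∪ c and still span e, against `hnot₁`. The same holds for
  -- c₂.
  have hcP : c ∉ P := fun hcP ↦
    hnot₁ e heL hes (M.closure_subset_closure (hQc c s hcP) hQP.mem_left)
  have hcP₂ : c₂ ∉ P := fun hcP ↦
    hnot₂ e heL het (M.closure_subset_closure (hQc c₂ t hcP) hQP.mem_left)
  have hPE := hQP.subset_right
  set P' := P \ {s, t} with hP'
  have hsP' : P' ⊆ M.E \ insert c₂ (L \ {t}) := fun z hz ↦ by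
    have h1 := hp z
    clear * - h1 hz hcP₂; grind
  have htP' : insert s P' ⊆ M.E \ insert c (L \ {s}) := fun z hz ↦ by
    have h1 := hp z
    clear * - h1 hz hcP hcs hsP; grind
  have hr1 := rkNat_insert_of_notMem_closure (hLE hsL)
    (fun hh ↦ hnot₂ s hsL (Ne.symm hts) (M.closure_subset_closure hsP' hh))
  have hr2 := rkNat_insert_of_notMem_closure (hLE htL)
    (fun hh ↦ hnot₁ t htL hts (M.closure_subset_closure htP' hh))
  have hPeq : insert t (insert s P') = P := by clear * - htP hsP; grind
  have hPc : M.E \ P' = insert t (insert s (insert e Q)) := by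
    ext z
    have h1 := hp z
    clear * - h1 hsP htP; grind
  have ht : t ∈ M.closure (insert s (insert e Q)) := M.closure_subset_closure
    (by clear * -; grind) (hM.subset_closure_pair hE hLE hLr.le hsL heL (Ne.symm hes) htL)
  have hr3 := M.rkNat_insert_le s (insert e Q)
  have hadd := hQP.add_eq
  have h3 := hQP.three_le_right
  rw [hPeq] at hr2
  rw [hQP.rkNat_insert_left] at hr3
  -- Removing s and t lowers the rank of P by 2, while adding L to Q raises its rank by at most 1.
  -- Hence λ(P') ≤ 1, so P' has at most one element; it is nonempty because r(P) ≥ 3. Thus P = (L \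
  -- e) ∪ d is the third set.
  obtain ⟨d, hd⟩ : ∃ d, P' = {d} := by
    refine exists_eq_singleton_iff_nonempty_subsingleton.2 ⟨?_, not_nontrivial_iff.1 fun hnt ↦ ?_⟩
    · rw [nonempty_iff_ne_empty]
      intro h0
      have h4 : M.rkNat P' = 0 := by rw [h0, rkNat_empty]
      omega
    · have h4 := hM.add_two_le (sdiff_subset.trans hPE) hnt
        ⟨s, ⟨hLE hsL, by simp⟩, t, ⟨hLE htL, by simp⟩, Ne.symm hts⟩
      rw [rkSum, ← hP', hPc, rkNat_insert_of_mem_closure ht] at h4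
      omega
  have hdP : d ∈ P' := by simp [hd]
  have hdp := hp d
  refine hco s (.inr hs) hsK (isNConnected_co_si_contract hM hE hLr hLcl hsL htL heL (Ne.symm hts)
    (Ne.symm hes) (Ne.symm het) hcE (hY c₂ hc₂) (d₃ := d) (by clear * - hdp hdP; grind) hrs hr₂ ?_)
  convert hQP.rkNat_compl_lt using 3
  ext z
  have h1 := hp z
  have h2 : z ∈ P' ↔ z = d := by simp [hd]
  clear * - h1 h2 hsP htP; grind

end Core

end Matroid

namespace Matroid

variable {α β : Type*} {M : Matroid α} {N : Matroid β} {X Y Z K : Set α} {s x z : α}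

/-! ### Choice of a minimal separation and conclusion. -/

section Final

/-- Orthogonality: a circuit and a cocircuit never meet in exactly one element. -/
lemma IsCocircuit.inter_nonempty_of_mem_closure (hK : M.IsCocircuit K) (hz : z ∈ K)
    (hZ : z ∈ M.closure Z) : (Z ∩ K).Nonempty := by
  by_cases hzZ : z ∈ Z
  · exact ⟨z, hzZ, hz⟩
  obtain ⟨C, hC, hCi, hzC⟩ := exists_isCircuit_of_mem_closure hZ hzZ
  obtain ⟨w, hw, hwz⟩ := (hCi.isCocircuit_inter_nontrivial hK ⟨z, hzC, hz⟩).exists_ne z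
  exact ⟨w, (hC hw.1).resolve_left hwz, hw.2⟩

lemma HasMinor.five_le_encard (h : (M ／ {x}).HasMinor N) (hcard : 4 ≤ N.E.encard)
    (hx : x ∈ M.E) : 5 ≤ M.E.encard := by
  obtain ⟨N₁, h1, hiso⟩ := h
  have h2 := h1.subset
  rw [contract_ground] at h2
  rw [← hiso.encard_ground] at hcard
  rw [← encard_sdiff_singleton_add_one hx]
  have h3 := hcard.trans (encard_le_encard h2)
  calc (5 : ℕ∞) = 4 + 1 := by norm_num
    _ ≤ _ := by gcongr

variable [M.Finite]

lemma HasMinor.si (h : M.HasMinor N) (hN : N.IsNConnected 3) (hcard : 4 ≤ N.E.encard) :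
    M.si.HasMinor N := by
  obtain ⟨N₁, h1, hiso⟩ := h
  obtain ⟨N₂, h2, hiso₂⟩ := h1.exists_isIsomorphic_si (hiso.isNConnected hN)
    (by rwa [hiso.encard_ground])
  exact ⟨N₂, h2, hiso₂.symm.trans hiso⟩

lemma HasMinor.co (h : M.HasMinor N) (hN : N.IsNConnected 3) (hcard : 4 ≤ N.E.encard) :
    M.co.HasMinor N := by
  obtain ⟨N₁, h1, hiso⟩ := h
  obtain ⟨N₂, h2, hiso₂⟩ := h1.exists_isIsomorphic_co (hiso.isNConnected hN)
    (by rwa [hiso.encard_ground])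
  exact ⟨N₂, h2, hiso₂.symm.trans hiso⟩

/-- Minimality is taken over all X that occur in a closed separation at any point of K with an
N-minor having at most one element in X. Since contracting s ∈ X preserves this last condition, a
separation at s ∈ K with a side inside X is again a competitor. -/
lemma exists_isMinVertSep (hM : M.IsNConnected 3) (hN : N.IsNConnected 3)
    (hcard : 4 ≤ N.E.encard) (hK : M.IsCocircuit K) (hx : x ∈ K) (h : M.IsVertSep X x Y)
    (hmin : (M ／ {x}).HasMinor N) :
    ∃ X x Y, M.IsMinVertSep K X x Y ∧ ∀ s ∈ insert x X, (M ／ {s}).HasMinor N := by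
  let p : Set α → Prop := fun X ↦ ∃ x ∈ K, ∃ Y, M.IsClosedVertSep X x Y ∧
    ∃ N', N' ≤m M ／ {x} ∧ N'.IsIsomorphic N ∧ (X ∩ N'.E).Subsingleton
  have hp : ∀ x ∈ K, ∀ X Y N', M.IsVertSep X x Y → N' ≤m M ／ {x} → N'.IsIsomorphic N →
      (X ∩ N'.E).Subsingleton → ∃ Z ⊆ X, p Z := by
    intro x hx X Y N' h hN' hiso hsub
    obtain ⟨X', Y', h1, h2, -, h3⟩ := h.exists_closed hM
    exact ⟨X', h2, x, hx, Y', ⟨h1, h3⟩, N', hN', hiso,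
      hsub.anti (inter_subset_inter_left _ h2)⟩
  have hfin : {X | p X}.Finite := by
    refine M.ground_finite.finite_subsets.subset ?_
    rintro X ⟨x, -, Y, hXY, -⟩
    exact hXY.subset_left
  have hne : {X | p X}.Nonempty := by
    obtain ⟨N', hN', hiso⟩ := hmin
    obtain hsub | hsub := h.subsingleton_or_subsingleton hM hN' (hiso.isNConnected hN)
    · obtain ⟨Z, -, hZ⟩ := hp x hx X Y N' h hN' hiso hsub
      exact ⟨Z, hZ⟩
    · obtain ⟨Z, -, hZ⟩ := hp x hx Y X N' h.symm hN' hiso hsub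
      exact ⟨Z, hZ⟩
  obtain ⟨X, hX⟩ := hfin.exists_minimal hne
  obtain ⟨x, hx, Y, hXY, N', hN', hiso, hsub⟩ := hX.prop
  have hgood : ∀ s ∈ X, ∃ N', N' ≤m M ／ {s} ∧ N'.IsIsomorphic N ∧ (X ∩ N'.E).Subsingleton := by
    intro s hs
    obtain ⟨N₂, h1, h2, h3⟩ := hXY.exists_isIsomorphic_contract hM hN' (hiso.isNConnected hN)
      (by rwa [hiso.encard_ground]) hsub hs (hXY.notMem_closure hs)
    exact ⟨N₂, h1, h2.symm.trans hiso, h3⟩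
  refine ⟨X, x, Y, ⟨hXY, hx, fun z hz Z hZ ↦ hK.inter_nonempty_of_mem_closure hz hZ, ?_⟩, ?_⟩
  · intro s hs hsK Z W hZW hZX
    obtain ⟨N₂, h1, h2, h3⟩ := hgood s hs
    obtain ⟨Z', hZ', hpZ⟩ := hp s hsK Z W N₂ hZW h1 h2 (h3.anti (inter_subset_inter_left _ hZX))
    -- Minimality gives X ⊆ Z' ⊆ Z, so s ∈ Z, but s belongs to neither side of its own separation.
    exact hZW.notMem_left (hZ' (hX.le_of_le hpZ (hZ'.trans hZX) hs))
  · rintro s (rfl | hs)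
    · exact ⟨N', hN', hiso⟩
    · obtain ⟨N₂, h1, h2, -⟩ := hgood s hs
      exact ⟨N₂, h1, h2⟩

end Final

end Matroid

theorem mainTheorem2 {α : Type*} {β : Type*} (M : Matroid α) (N : Matroid β)
    [M.Finite] [N.Finite]
    (hM : M.IsNConnected 3) (hN : N.IsNConnected 3) (hcard : 4 ≤ N.E.encard)
    (C : Set α) (hC : M.IsCocircuit C)
    (hx : ∃ x₀ ∈ C, (M ／ {x₀}).HasMinor N) :
    (∃ x ∈ C, (M ／ {x}).si.IsNConnected 3 ∧ (M ／ {x}).si.HasMinor N) ∨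
    (∃ x ∈ C, (M ／ {x}).si.co.IsNConnected 3 ∧ (M ／ {x}).si.co.HasMinor N) ∨
    (∃ x₁ x₂ x₃ x₄ : α, M.IsFourElementFan x₁ x₂ x₃ x₄ ∧ x₁ ∈ C ∧ x₃ ∈ C ∧
      (M ／ {x₂}).si.IsNConnected 3 ∧ (M ／ {x₂}).si.HasMinor N) := by
  by_contra! hcon
  obtain ⟨h1, h2, h3⟩ := hcon
  obtain ⟨x₀, hx₀, hmin₀⟩ := hx
  have hE := hmin₀.five_le_encard hcard (hC.subset_ground hx₀)
  have hE4 : 4 ≤ M.E.encard := le_trans (by norm_num) hE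
  have hsi : ∀ s ∈ C, (M ／ {s}).HasMinor N → ∃ X Y, M.IsVertSep X s Y := fun s hs hm ↦
    Matroid.exists_isVertSep hM hE (hC.subset_ground hs) fun h ↦ h1 s hs h (hm.si hN hcard)
  obtain ⟨X₀, Y₀, h₀⟩ := hsi x₀ hx₀ hmin₀
  obtain ⟨X, x, Y, hX, hgood⟩ := Matroid.exists_isMinVertSep hM hN hcard hC hx₀ h₀ hmin₀
  refine hX.false hM hE4 (fun s hs hsC ↦ hsi s hsC (hgood s (.inr hs))) ?_ ?_
  · intro x₁ x₂ x₃ x₄ hfan hx₁ hx₃ hx₂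
    exact Matroid.exists_isVertSep hM hE (hX.subset_left hx₂) fun h ↦
      h3 x₁ x₂ x₃ x₄ hfan hx₁ hx₃ h ((hgood x₂ (.inr hx₂)).si hN hcard)
  · exact fun s hs hsC h ↦ h2 s hsC h (((hgood s hs).si hN hcard).co hN hcard)
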